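/- Let $d\ge 1$, $0<s<1$, and let $\Omega\subset\mathbb{R}^d$ be a bounded open set. Let $g=g(x,y,r)>0$ be a measurable function on $\mathbb{R}^d\times\mathbb{R}^d\times(0,\infty)$ such that, for a.e. $(x,y)$, $g(x,y,\cdot)$ is locally Lipschitz on $(0,\infty)$, $\lim_{r\to0^+}rg(x,y,r)=0$, $\lim_{r\to\infty}rg(x,y,r)=\infty$ and $$0<g_*\le\frac{r\,\partial_r g(x,y,r)}{g(x,y,r)}+1\le g^*\qquad\text{for a.e. } r>0,$$ with constants $0<g_*\le g^*$. Put $\delta^su(x,y)=\frac{u(x)-u(y)}{|x-y|^s}$, $G(x,y,r)=\int_0^r g(x,y,\rho)\rho\,d\rho$, $$\Gamma(u)=\int_{\mathbb{R}^d}\int_{\mathbb{R}^d}G(x,y,|\delta^su|)\frac{dx\,dy}{|x-y|^d},\qquad [u]=\inf\{\lambda>0:\Gamma(u/\lambda)\le1\}.$$ Let $W_0$ (that is, $W^{s,G}_0(\Omega)$) be the space of measurable functions $u$ on $\mathbb{R}^d$, modulo equality a.e., with $u=0$ outside $\Omega$ and $\Gamma(u)<\infty$, that are limits of functions of $C_c^\infty(\Omega)$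 in the norm $[\cdot]$. Let $W_0^*$ be its dual, ordered by $F\ge\hat F$ iff $\langle F,v\rangle\ge\langle\hat F,v\rangle$ for all $v\in W_0$ with $v\ge0$ a.e. in $\Omega$. Then for all $u,v\in W_0$ the integral $$\langle\mathcal{L}_g^su,v\rangle=\int_{\mathbb{R}^d}\int_{\mathbb{R}^d}g(x,y,|\delta^su|)\,\delta^su\,\delta^sv\,\frac{dx\,dy}{|x-y|^d}$$ converges absolutely. For $F\in W_0^*$ and measurable $\psi,\varphi$ on $\Omega$, let $\mathbb{K}=\mathbb{K}_1=\{v\in W_0: v\ge\psi\text{ a.e. in }\Omega\}$ (one obstacle) or $\mathbb{K}=\mathbb{K}_2=\{v\in W_0:\psi\le v\le\varphi\text{ a.e. in }\Omega\}$ (two obstacles), and suppose that $\mathbb{K}\ne\emptyset$. 1. There is a unique $u\in\mathbb{K}$ with $\langle\mathcal{L}_g^su-F,v-u\rangle\ge0$ for all $v\in\mathbb{K}$. Moreover, $u\in\mathbb{K}$ has this property if and only if it minimises $\mathcal{G}_s(v)=\Gamma(v)-\langle F,v\rangle$ over $\mathbb{K}$. 2. Let $u$ be the solution for the data $F,\psi$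 (respectively $F,\psi,\varphi$) and $\hat u$ the solution of the problem of the same kind for $\hat F,\hat\psi$ (respectively $\hat F,\hat\psi,\hat\varphi$). If $F\ge\hat F$ and $\psi\ge\hat\psi$ a.e. in $\Omega$ (respectively, and in addition $\varphi\ge\hat\varphi$ a.e. in $\Omega$), then $u\ge\hat u$ a.e. in $\Omega$. 3. If $F=\hat F$, then $\|u-\hat u\|_{L^\infty(\Omega)}\le\|\psi-\hat\psi\|_{L^\infty(\Omega)}$ for one obstacle and $\|u-\hat u\|_{L^\infty(\Omega)}\le\|\psi-\hat\psi\|_{L^\infty(\Omega)}\vee\|\varphi-\hat\varphi\|_{L^\infty(\Omega)}$ for two obstacles, where the right-hand sides may be infinite. -/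

import Mathlib

open MeasureTheory Filter Topology
open scoped ENNReal NNReal

noncomputable section

namespace FracObstacle

/-- The Euclidean space `ℝᵈ`. -/
abbrev Rd (d : ℕ) : Type := EuclideanSpace ℝ (Fin d)

/-- The structural assumptions on the nonlinearity `g(x, y, r)`, `r > 0`, with the constants
`g_* = gl` and `g^* = gu`.

* `measurable`: `g` is a measurable function.  Since `g` is continuous in `r`, joint Lebesgue
  measurability amounts to Lebesgue measurability of `g(·, ·, r)` for every `r > 0`.
* `growth`: `g(x, y, ·)` is locally Lipschitz on `(0, ∞)`, so that it is differentiable at almost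
  every `r > 0`; the growth condition is required at almost every `r > 0`. -/
structure IsAdmissible {d : ℕ} (g : Rd d → Rd d → ℝ → ℝ) (gl gu : ℝ) : Prop where
  gl_pos : 0 < gl
  gl_le_gu : gl ≤ gu
  measurable : ∀ r : ℝ, 0 < r → AEMeasurable (fun p : Rd d × Rd d => g p.1 p.2 r) volume
  pos : ∀ᵐ p : Rd d × Rd d, ∀ r : ℝ, 0 < r → 0 < g p.1 p.2 r
  lipschitz : ∀ᵐ p : Rd d × Rd d, LocallyLipschitzOn (Set.Ioi (0 : ℝ)) (g p.1 p.2)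
  tendsto_zero : ∀ᵐ p : Rd d × Rd d,
    Tendsto (fun r : ℝ => r * g p.1 p.2 r) (𝓝[>] 0) (𝓝 0)
  tendsto_atTop : ∀ᵐ p : Rd d × Rd d,
    Tendsto (fun r : ℝ => r * g p.1 p.2 r) atTop atTop
  growth : ∀ᵐ p : Rd d × Rd d, ∀ᵐ r : ℝ, 0 < r →
    gl ≤ r * deriv (g p.1 p.2) r / g p.1 p.2 r + 1 ∧
      r * deriv (g p.1 p.2) r / g p.1 p.2 r + 1 ≤ gu

/-- `G(x, y, r) = ∫₀ʳ g(x, y, ρ) ρ dρ`. -/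
def primitiveG {d : ℕ} (g : Rd d → Rd d → ℝ → ℝ) (x y : Rd d) (r : ℝ) : ℝ :=
  ∫ ρ in (0 : ℝ)..r, g x y ρ * ρ

/-- The difference quotient `δˢu(x, y) = (u(x) - u(y)) / |x - y|ˢ`. -/
def fracDiff {d : ℕ} (s : ℝ) (u : Rd d → ℝ) (x y : Rd d) : ℝ :=
  (u x - u y) / ‖x - y‖ ^ s

/-- The modular `Γ_{s,G}(u) = ∬ G(x, y, |δˢu(x, y)|) dx dy / |x - y|ᵈ ∈ [0, ∞]`. -/
def modular {d : ℕ} (g : Rd d → Rd d → ℝ → ℝ) (s : ℝ) (u : Rd d → ℝ) : ℝ≥0∞ :=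
  ∫⁻ p : Rd d × Rd d,
    ENNReal.ofReal (primitiveG g p.1 p.2 |fracDiff s u p.1 p.2| / ‖p.1 - p.2‖ ^ d)

/-- The Luxemburg norm `[u]_{s,G} = inf {t > 0 : Γ_{s,G}(u / t) ≤ 1} ∈ [0, ∞]`
(it is `∞` if there is no such `t`). -/
def luxemburg {d : ℕ} (g : Rd d → Rd d → ℝ → ℝ) (s : ℝ) (u : Rd d → ℝ) : ℝ≥0∞ :=
  ⨅ (t : ℝ) (_ : 0 < t ∧ modular g s (fun x => u x / t) ≤ 1), ENNReal.ofReal t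

/-- `φ ∈ C_c^∞(Ω)`. -/
def IsTestFunction {d : ℕ} (Ω : Set (Rd d)) (φ : Rd d → ℝ) : Prop :=
  ContDiff ℝ (⊤ : ℕ∞) φ ∧ HasCompactSupport φ ∧ tsupport φ ⊆ Ω

/-- The space `W_0^{s,G}(Ω)`: the measurable functions on `ℝᵈ` that vanish outside `Ω`, have finite
modular, and are limits of functions in `C_c^∞(Ω)` in the norm `[·]_{s,G}`.  Its elements are
functions; two of them that are equal almost everywhere represent the same element. -/
def W0 {d : ℕ} (g : Rd d → Rd d → ℝ → ℝ) (s : ℝ) (Ω : Set (Rd d)) : Set (Rd d → ℝ) :=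
  {u | AEMeasurable u volume ∧ (∀ x, x ∉ Ω → u x = 0) ∧ modular g s u < ∞ ∧
    ∀ ε : ℝ, 0 < ε → ∃ φ : Rd d → ℝ, IsTestFunction Ω φ ∧
      luxemburg g s (fun x => u x - φ x) < ENNReal.ofReal ε}

/-- `F` is an element of the dual of `W_0^{s,G}(Ω)`: a bounded linear functional on that space.
Only the values of `F` on `W_0^{s,G}(Ω)` matter. -/
structure IsDualElement {d : ℕ} (g : Rd d → Rd d → ℝ → ℝ) (s : ℝ) (Ω : Set (Rd d))
    (F : (Rd d → ℝ) → ℝ) : Prop where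
  map_add : ∀ u ∈ W0 g s Ω, ∀ v ∈ W0 g s Ω, F (u + v) = F u + F v
  map_smul : ∀ c : ℝ, ∀ u ∈ W0 g s Ω, F (c • u) = c * F u
  bound : ∃ C : ℝ≥0, ∀ u ∈ W0 g s Ω, ENNReal.ofReal |F u| ≤ C * luxemburg g s u

/-- `F ≥ F'` in the dual of `W_0^{s,G}(Ω)`: `⟨F', v⟩ ≤ ⟨F, v⟩` for all `v ≥ 0` in `W_0^{s,G}(Ω)`. -/
def DualGE {d : ℕ} (g : Rd d → Rd d → ℝ → ℝ) (s : ℝ) (Ω : Set (Rd d))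
    (F F' : (Rd d → ℝ) → ℝ) : Prop :=
  ∀ v ∈ W0 g s Ω, (∀ᵐ x ∂volume.restrict Ω, 0 ≤ v x) → F' v ≤ F v

/-- The integrand `g(x, y, |δˢu|) δˢu δˢv / |x - y|ᵈ` of `⟨ℒ_g^s u, v⟩`. -/
def opIntegrand {d : ℕ} (g : Rd d → Rd d → ℝ → ℝ) (s : ℝ) (u v : Rd d → ℝ)
    (p : Rd d × Rd d) : ℝ :=
  g p.1 p.2 |fracDiff s u p.1 p.2| * fracDiff s u p.1 p.2 * fracDiff s v p.1 p.2
    / ‖p.1 - p.2‖ ^ d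

/-- `⟨ℒ_g^s u, v⟩`. -/
def opL {d : ℕ} (g : Rd d → Rd d → ℝ → ℝ) (s : ℝ) (u v : Rd d → ℝ) : ℝ :=
  ∫ p : Rd d × Rd d, opIntegrand g s u v p

/-- The functional `𝒢_s(v) = Γ_{s,G}(v) - ⟨F, v⟩` (the modular is finite on `W_0^{s,G}(Ω)`). -/
def energy {d : ℕ} (g : Rd d → Rd d → ℝ → ℝ) (s : ℝ) (F : (Rd d → ℝ) → ℝ)
    (v : Rd d → ℝ) : ℝ :=
  (modular g s v).toReal - F v

/-- The convex set of the one-obstacle problem: `v ≥ ψ` a.e. in `Ω`. -/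
def K1 {d : ℕ} (g : Rd d → Rd d → ℝ → ℝ) (s : ℝ) (Ω : Set (Rd d)) (ψ : Rd d → ℝ) :
    Set (Rd d → ℝ) :=
  {v | v ∈ W0 g s Ω ∧ ∀ᵐ x ∂volume.restrict Ω, ψ x ≤ v x}

/-- The convex set of the two-obstacle problem: `ψ ≤ v ≤ φ` a.e. in `Ω`. -/
def K2 {d : ℕ} (g : Rd d → Rd d → ℝ → ℝ) (s : ℝ) (Ω : Set (Rd d)) (ψ φ : Rd d → ℝ) :
    Set (Rd d → ℝ) :=
  {v | v ∈ W0 g s Ω ∧ ∀ᵐ x ∂volume.restrict Ω, ψ x ≤ v x ∧ v x ≤ φ x}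

/-- `u` solves the obstacle problem in `K`: `u ∈ K` and `⟨ℒ_g^s u - F, v - u⟩ ≥ 0` for all
`v ∈ K`. -/
def IsSolution {d : ℕ} (g : Rd d → Rd d → ℝ → ℝ) (s : ℝ) (K : Set (Rd d → ℝ))
    (F : (Rd d → ℝ) → ℝ) (u : Rd d → ℝ) : Prop :=
  u ∈ K ∧ ∀ v ∈ K, 0 ≤ opL g s u (v - u) - F (v - u)

/-- `u` minimises `𝒢_s` over `K`. -/
def IsMinimiser {d : ℕ} (g : Rd d → Rd d → ℝ → ℝ) (s : ℝ) (K : Set (Rd d → ℝ))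
    (F : (Rd d → ℝ) → ℝ) (u : Rd d → ℝ) : Prop :=
  u ∈ K ∧ ∀ v ∈ K, energy g s F u ≤ energy g s F v

/-- The obstacle problem in `K` has a solution, and any two solutions are equal a.e. -/
def HasUniqueSolution {d : ℕ} (g : Rd d → Rd d → ℝ → ℝ) (s : ℝ) (K : Set (Rd d → ℝ))
    (F : (Rd d → ℝ) → ℝ) : Prop :=
  ∃ u, IsSolution g s K F u ∧ ∀ w, IsSolution g s K F w → w =ᵐ[volume] u

/-- The norm of `L^∞(Ω)`, with values in `[0, ∞]`. -/
def supNorm {d : ℕ} (Ω : Set (Rd d)) (f : Rd d → ℝ) : ℝ≥0∞ :=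
  eLpNorm f ∞ (volume.restrict Ω)

end FracObstacle

end

namespace FracObstacle

/-! ### Functions of controlled growth -/

/-! The growth condition says that `r g(x, y, r)` lies between the powers `gl` and `gu` of `r` in
the sense of scaling. Hence, for almost every pair, `G(x, y, |·|)` is an even convex function whose
derivative is strictly increasing, and all constants in its inequalities depend on the two exponents
only. Pointwise inequalities therefore integrate over the pairs `(x, y)`: this gives finiteness of
the pairing, equivalence of small modular and small Luxemburg norm, and a uniform convexity
inequality for the modular (`exists_uniform_convexity_const`).

Existence is the direct method without weak compactness. Young's inequality makes the energy
coercive (`exists_coercive`). The constraint set contains midpoints and `F` is linear, so uniform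
convexity makes a minimising sequence Cauchy in modular. The space is complete (`W0.complete`),
because vanishing outside the bounded set `Ω` lets the difference quotients determine the function,
and Fatou's lemma shows that the limit is a minimiser. Convexity and differentiation along segments
identify minimisers with solutions (`isSolution_iff_isMinimiser`).

Uniqueness, comparison and the sup-norm estimate all come from `IsSolution.le_add`: test both
inequalities with `w = (u' - u - k)⁺` and add. Strict monotonicity of the derivative forces the
quotient of `w` to vanish, so `w = 0`. Comparison is `k = 0`, uniqueness is comparison in both
directions, and the sup-norm bound takes `k` to be the distance between the obstacles. That `w` is
admissible rests on `W0.trunc_mem`, where the truncation is approximated by smooth contractions of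
test functions. -/

/-- An even convex function `H` with odd, continuous, strictly increasing derivative `A`, whose
growth lies between the powers `gl + 1` and `gu + 1`. -/
structure GrowthPair (gl gu : ℝ) (A H : ℝ → ℝ) : Prop where
  gl_pos : 0 < gl
  gl_le_gu : gl ≤ gu
  zero : H 0 = 0
  even : ∀ t, H (-t) = H t
  odd : ∀ t, A (-t) = -A t
  strictMono : StrictMono A
  continuous : Continuous A
  tangent : ∀ x y, A y * (x - y) ≤ H x - H y
  scale : ∀ c r, 0 ≤ c → c ≤ 1 → 0 ≤ r → A (c * r) ≤ c ^ gl * A r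
  scale_up : ∀ c t, 1 ≤ c → H (c * t) ≤ c ^ (gu + 1) * H t
  scale_down : ∀ c t, 0 ≤ c → c ≤ 1 → H (c * t) ≤ c ^ (gl + 1) * H t

namespace GrowthPair

variable {gl gu : ℝ} {A H : ℝ → ℝ}

lemma deriv_zero (h : GrowthPair gl gu A H) : A 0 = 0 := by
  have := h.odd 0
  simp only [neg_zero] at this
  linarith

lemma deriv_pos (h : GrowthPair gl gu A H) {t : ℝ} (ht : 0 < t) : 0 < A t := by
  simpa [h.deriv_zero] using h.strictMono ht

lemma deriv_nonneg (h : GrowthPair gl gu A H) {t : ℝ} (ht : 0 ≤ t) : 0 ≤ A t := by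
  simpa [h.deriv_zero] using h.strictMono.monotone ht

lemma abs_eq (h : GrowthPair gl gu A H) (t : ℝ) : H |t| = H t := by
  rcases abs_choice t with ht | ht <;> rw [ht]
  exact h.even t

lemma deriv_abs (h : GrowthPair gl gu A H) (t : ℝ) : |A t| = A |t| := by
  rcases le_total 0 t with ht | ht
  · rw [abs_of_nonneg ht, abs_of_nonneg (h.deriv_nonneg ht)]
  · rw [abs_of_nonpos ht, h.odd, abs_of_nonpos]
    have := h.deriv_nonneg (neg_nonneg.2 ht)
    rw [h.odd] at this
    linarith

lemma nonneg (h : GrowthPair gl gu A H) (t : ℝ) : 0 ≤ H t := by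
  have := h.tangent t 0
  rw [h.deriv_zero, h.zero] at this
  linarith

lemma mono_of_nonneg (h : GrowthPair gl gu A H) {a b : ℝ} (ha : 0 ≤ a) (hab : a ≤ b) :
    H a ≤ H b := by
  have h1 := h.tangent b a
  have h2 := mul_nonneg (h.deriv_nonneg ha) (sub_nonneg.2 hab)
  linarith

lemma mono_abs (h : GrowthPair gl gu A H) {a b : ℝ} (hab : |a| ≤ |b|) : H a ≤ H b := by
  rw [← h.abs_eq a, ← h.abs_eq b]
  exact h.mono_of_nonneg (abs_nonneg a) hab

lemma pos (h : GrowthPair gl gu A H) {t : ℝ} (ht : t ≠ 0) : 0 < H t := by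
  rw [← h.abs_eq t]
  have ht' := abs_pos.2 ht
  have h1 := h.tangent |t| (|t| / 2)
  have h2 := h.deriv_pos (half_pos ht')
  have h3 := h.nonneg (|t| / 2)
  have : 0 < A (|t| / 2) * (|t| - |t| / 2) := mul_pos h2 (by linarith)
  linarith

/-- The tangent inequalities based at `y` and at `x` squeeze `H x` between `H y + A y * (x - y)` and
`H y + A x * (x - y)`. -/
lemma continuous_primitive (h : GrowthPair gl gu A H) : Continuous H := by
  rw [continuous_iff_continuousAt]
  intro y
  have hl : Tendsto (fun x => H y + A y * (x - y)) (𝓝 y) (𝓝 (H y)) := by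
    have : Continuous fun x => H y + A y * (x - y) := by fun_prop
    simpa using this.tendsto y
  have hu : Tendsto (fun x => H y + A x * (x - y)) (𝓝 y) (𝓝 (H y)) := by
    have hA := h.continuous
    have : Continuous fun x => H y + A x * (x - y) := by fun_prop
    simpa using this.tendsto y
  refine tendsto_of_tendsto_of_tendsto_of_le_of_le hl hu (fun x => ?_) fun x => ?_
  · have := h.tangent x y
    simp only
    linarith
  · have := h.tangent y x
    simp only
    linarith

lemma convex (h : GrowthPair gl gu A H) {a b : ℝ} (ha : 0 ≤ a) (hb : 0 ≤ b) (hab : a + b = 1)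
    (x y : ℝ) : H (a * x + b * y) ≤ a * H x + b * H y := by
  have h1 := mul_le_mul_of_nonneg_left (h.tangent x (a * x + b * y)) ha
  have h2 := mul_le_mul_of_nonneg_left (h.tangent y (a * x + b * y)) hb
  obtain rfl : a = 1 - b := by linarith
  nlinarith

lemma midpoint (h : GrowthPair gl gu A H) (x y : ℝ) : H ((x + y) / 2) ≤ (H x + H y) / 2 := by
  have := h.convex (a := 1 / 2) (b := 1 / 2) (by norm_num) (by norm_num) (by norm_num) x y
  rw [show 1 / 2 * x + 1 / 2 * y = (x + y) / 2 by ring] at this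
  linarith

lemma doubling (h : GrowthPair gl gu A H) (t : ℝ) : H (2 * t) ≤ 2 ^ (gu + 1) * H t :=
  h.scale_up 2 t one_le_two

lemma add_le (h : GrowthPair gl gu A H) (x y : ℝ) :
    H (x + y) ≤ 2 ^ (gu + 1) * (H x + H y) := by
  have h1 := h.doubling ((x + y) / 2)
  rw [show 2 * ((x + y) / 2) = x + y by ring] at h1
  have h2 := h.midpoint x y
  have h3 : (0 : ℝ) < 2 ^ (gu + 1) := by positivity
  have h4 := h.nonneg x
  have h5 := h.nonneg y
  have : 2 ^ (gu + 1) * H ((x + y) / 2) ≤ 2 ^ (gu + 1) * (H x + H y) := by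
    gcongr
    linarith
  linarith

lemma sub_le (h : GrowthPair gl gu A H) (x y : ℝ) :
    H (x - y) ≤ 2 ^ (gu + 1) * (H x + H y) := by
  have := h.add_le x (-y)
  rwa [h.even, ← sub_eq_add_neg] at this

lemma abs_deriv_mul_self_le (h : GrowthPair gl gu A H) (t : ℝ) :
    |A t| * |t| ≤ 2 ^ (gu + 1) * H t := by
  have h1 := h.tangent (2 * |t|) |t|
  have h2 := h.doubling |t|
  have h3 := h.nonneg |t|
  rw [h.abs_eq] at h1 h2 h3
  rw [h.deriv_abs]
  have : A |t| * (2 * |t| - |t|) = A |t| * |t| := by ring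
  linarith

/-- A substitute for Young's inequality that avoids the conjugate function: by monotonicity of `A`
the product is at most `|A z| * |z|`, with `z` the larger of `x`, `y` in absolute value. -/
lemma abs_deriv_mul_le (h : GrowthPair gl gu A H) (x y : ℝ) :
    |A x * y| ≤ 2 ^ (gu + 1) * (H x + H y) := by
  have h1 := h.abs_deriv_mul_self_le x
  have h2 := h.abs_deriv_mul_self_le y
  have hx := h.nonneg x
  have hy := h.nonneg y
  have h3 : (0 : ℝ) < 2 ^ (gu + 1) := by positivity
  rw [abs_mul, mul_add]
  have hx' := mul_nonneg h3.le hx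
  have hy' := mul_nonneg h3.le hy
  rcases le_total |x| |y| with hxy | hxy
  · have : |A x| ≤ |A y| := by
      rw [h.deriv_abs, h.deriv_abs]
      exact h.strictMono.monotone hxy
    have : |A x| * |y| ≤ |A y| * |y| := by gcongr
    linarith
  · have : |A x| * |y| ≤ |A x| * |x| := by gcongr
    linarith

/-- The gap in the midpoint inequality is bounded below when the two points are far apart. -/
lemma midpoint_gap (h : GrowthPair gl gu A H) {ε : ℝ} (hε : 0 < ε) (hε1 : ε < 1) {a b : ℝ}
    (hab : ε * max |a| |b| ≤ |a - b|) :
    ε * (1 - (1 - ε / 2) ^ gl) / (8 * 2 ^ (gu + 1)) * (H a + H b) ≤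
      H a + H b - 2 * H ((a + b) / 2) := by
  have hD : (0 : ℝ) < 2 ^ (gu + 1) := by positivity
  wlog hle : |b| ≤ |a| generalizing a b
  · have := this (a := b) (b := a) (by rwa [max_comm, abs_sub_comm]) (le_of_not_ge hle)
    rwa [add_comm (H b), add_comm b] at this
  wlog ha : 0 ≤ a generalizing a b
  · have := this (a := -a) (b := -b)
      (by rwa [abs_neg, abs_neg, show -a - -b = -(a - b) by ring, abs_neg]) (by simpa using hle)
      (by linarith)
    rwa [h.even, h.even, show (-a + -b) / 2 = -((a + b) / 2) by ring, h.even] at this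
  rw [max_eq_left hle, abs_of_nonneg ha] at hab
  have hba := abs_le.1 hle
  rw [abs_of_nonneg ha] at hba
  rw [abs_of_nonneg (by linarith)] at hab
  rcases ha.eq_or_lt with rfl | ha'
  · obtain rfl : b = 0 := by linarith
    simp [h.zero]
  set m := (a + b) / 2 with hm
  set t := (a - b) / 2 with ht
  have hma : m + t = a := by rw [hm, ht]; ring
  have hmb : m - t = b := by rw [hm, ht]; ring
  have hm0 : 0 ≤ m := by linarith
  have ht0 : 0 < t := by nlinarith
  -- With `a = m + t` and `b = m - t`, the tangent inequalities through the intermediate points `m ±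
  -- t / 2` add up to a gap of at least `t / 2 * (A (m + t / 2) - A (m - t / 2))`; the terms with `A
  -- m` cancel.
  have h1 := h.tangent a (m + t / 2)
  have h2 := h.tangent (m + t / 2) m
  have h3 := h.tangent b (m - t / 2)
  have h4 := h.tangent (m - t / 2) m
  have hcpos : (1 - ε / 2) ^ gl < 1 := Real.rpow_lt_one (by linarith) (by linarith) h.gl_pos
  have hApos : 0 < A (m + t / 2) := h.deriv_pos (by linarith)
  -- As `t ≥ ε * a / 2` and `m + t / 2 ≤ a`, the lower point, possibly negative, is at most `1 - ε /
  -- 2` times the upper one.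
  have h5 : A (m - t / 2) ≤ (1 - ε / 2) ^ gl * A (m + t / 2) := by
    have hmono : m - t / 2 ≤ (1 - ε / 2) * (m + t / 2) := by nlinarith
    refine (h.strictMono.monotone hmono).trans ?_
    exact h.scale _ _ (by linarith) (by linarith) (by linarith)
  -- Here `b ≥ -a` gives `a / 2 ≤ m + t / 2`. Together with doubling this bounds `H a`, hence `H b`,
  -- by a multiple of `a * A (m + t / 2)`.
  have h6 : A (a / 2) ≤ A (m + t / 2) := h.strictMono.monotone (by linarith)
  have h7 : H a ≤ 2 ^ (gu + 1) * (A (a / 2) * (a / 2)) := by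
    have e1 := h.doubling (a / 2)
    rw [show 2 * (a / 2) = a by ring] at e1
    have e2 := h.tangent 0 (a / 2)
    rw [h.zero] at e2
    have : H (a / 2) ≤ A (a / 2) * (a / 2) := by linarith
    exact e1.trans (by gcongr)
  have h8 : H b ≤ H a := h.mono_abs hle
  have key : t / 2 * ((1 - (1 - ε / 2) ^ gl) * A (m + t / 2)) ≤ H a + H b - 2 * H m := by
    have e1 : A (m + t / 2) * (a - (m + t / 2)) = A (m + t / 2) * (t / 2) := by rw [← hma]; ring
    have e2 : A m * (m + t / 2 - m) = A m * (t / 2) := by ring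
    have e3 : A (m - t / 2) * (b - (m - t / 2)) = -(A (m - t / 2) * (t / 2)) := by
      rw [← hmb]; ring
    have e4 : A m * (m - t / 2 - m) = -(A m * (t / 2)) := by ring
    have e5 : A (m - t / 2) * (t / 2) ≤ (1 - ε / 2) ^ gl * A (m + t / 2) * (t / 2) := by gcongr
    have e6 : t / 2 * ((1 - (1 - ε / 2) ^ gl) * A (m + t / 2)) =
      A (m + t / 2) * (t / 2) - (1 - ε / 2) ^ gl * A (m + t / 2) * (t / 2) := by ring
    linarith
  refine le_trans ?_ key
  set c := 1 - (1 - ε / 2) ^ gl with hc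
  have hc0 : 0 < c := by linarith
  have hta : ε * a / 2 ≤ t := by linarith
  have hA2 : 0 ≤ A (a / 2) := h.deriv_nonneg (by linarith)
  calc ε * c / (8 * 2 ^ (gu + 1)) * (H a + H b)
      ≤ ε * c / (8 * 2 ^ (gu + 1)) * (2 * (2 ^ (gu + 1) * (A (a / 2) * (a / 2)))) := by
        gcongr
        linarith
    _ = ε * a / 2 / 2 * (c * A (a / 2)) / 2 := by
        field_simp
        ring
    _ ≤ ε * a / 2 / 2 * (c * A (a / 2)) := by
        have : 0 ≤ ε * a / 2 / 2 * (c * A (a / 2)) := by positivity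
        linarith
    _ ≤ t / 2 * (c * A (m + t / 2)) := by gcongr

end GrowthPair

/-- Uniform convexity, with a constant that depends only on the growth exponents. -/
lemma exists_uniform_convexity_const (gl gu : ℝ) (hgl : 0 < gl) {ε : ℝ} (hε : 0 < ε) :
    ∃ C : ℝ, 0 ≤ C ∧ ∀ A H : ℝ → ℝ, GrowthPair gl gu A H → ∀ a b : ℝ,
      H (a - b) ≤ C * ((H a + H b) / 2 - H ((a + b) / 2)) + ε * (H a + H b) := by
  have hD : (0 : ℝ) < 2 ^ (gu + 1) := by positivity
  set η := min ε (1 / 2) with hη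
  have hη0 : 0 < η := lt_min hε (by norm_num)
  have hη1 : η < 1 := (min_le_right _ _).trans_lt (by norm_num)
  have hηε : η ≤ ε := min_le_left _ _
  have hc : (1 - η / 2) ^ gl < 1 := Real.rpow_lt_one (by linarith) (by linarith) hgl
  set κ := η * (1 - (1 - η / 2) ^ gl) / (8 * 2 ^ (gu + 1)) with hκ
  have hκ0 : 0 < κ := by
    have : 0 < 1 - (1 - η / 2) ^ gl := by linarith
    positivity
  refine ⟨2 * (2 ^ (gu + 1) / κ), by positivity, fun A H h a b => ?_⟩
  have ha := h.nonneg a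
  have hb := h.nonneg b
  have hmid := h.midpoint a b
  have hgap : 0 ≤ (H a + H b) / 2 - H ((a + b) / 2) := by linarith
  -- Far points are controlled by the midpoint gap. For close points `H (a - b)` is at most `η ^ (gl
  -- + 1) ≤ η ≤ ε` times `H (max |a| |b|)`.
  by_cases hab : η * max |a| |b| ≤ |a - b|
  · have h1 := h.midpoint_gap hη0 hη1 hab
    rw [← hκ] at h1
    have h2 := h.sub_le a b
    have h3 : 2 ^ (gu + 1) * (H a + H b) =
        2 ^ (gu + 1) / κ * (κ * (H a + H b)) := by field_simp
    have h4 : 2 ^ (gu + 1) / κ * (κ * (H a + H b)) ≤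
        2 ^ (gu + 1) / κ * (H a + H b - 2 * H ((a + b) / 2)) := by gcongr
    have h5 : 0 ≤ ε * (H a + H b) := by positivity
    have h6 : 2 * (2 ^ (gu + 1) / κ) * ((H a + H b) / 2 - H ((a + b) / 2)) =
      2 ^ (gu + 1) / κ * (H a + H b - 2 * H ((a + b) / 2)) := by ring
    linarith
  · push Not at hab
    have hmax : 0 ≤ max |a| |b| := (abs_nonneg a).trans (le_max_left _ _)
    have h1 : H (a - b) ≤ H (η * max |a| |b|) := by
      apply h.mono_abs
      rw [abs_of_nonneg (mul_nonneg hη0.le hmax)]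
      exact hab.le
    have h2 := h.scale_down η (max |a| |b|) hη0.le hη1.le
    have h3 : η ^ (gl + 1) ≤ ε := by
      have : η ^ (gl + 1) ≤ η ^ (1 : ℝ) :=
        Real.rpow_le_rpow_of_exponent_ge hη0 hη1.le (by linarith)
      rw [Real.rpow_one] at this
      exact this.trans hηε
    have h4 : H (max |a| |b|) ≤ H a + H b := by
      rcases max_choice |a| |b| with h' | h' <;> rw [h', h.abs_eq] <;> linarith
    have h5 : η ^ (gl + 1) * H (max |a| |b|) ≤ ε * (H a + H b) := by
      have := h.nonneg (max |a| |b|)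
      gcongr
    have h6 : 0 ≤ 2 * (2 ^ (gu + 1) / κ) * ((H a + H b) / 2 - H ((a + b) / 2)) := by positivity
    linarith

/-! ### The growth condition on `g(x, y, ·)` -/

/-- If `σ (r f' + γ f) ≥ 0` a.e. for a locally Lipschitz function `f` on `(0, ∞)`, then
`σ f(r) r ^ γ` is nondecreasing. -/
lemma mul_rpow_mono {f : ℝ → ℝ} (hf : LocallyLipschitzOn (Set.Ioi (0 : ℝ)) f) {γ σ : ℝ}
    (hder : ∀ᵐ r : ℝ, 0 < r → 0 ≤ σ * (r * deriv f r + γ * f r))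
    {a b : ℝ} (ha : 0 < a) (hab : a ≤ b) :
    σ * (f a * a ^ γ) ≤ σ * (f b * b ^ γ) := by
  have hsub : Set.uIcc a b ⊆ Set.Ioi 0 := by
    rw [Set.uIcc_of_le hab]
    exact fun x hx => ha.trans_le hx.1
  -- On the compact interval `f` is Lipschitz, hence absolutely continuous, so the sign of the a.e.
  -- derivative can be integrated.
  obtain ⟨K, hK⟩ := (hf.mono hsub).exists_lipschitzOnWith_of_compact isCompact_uIcc
  have hfac := hK.absolutelyContinuousOnInterval
  have hp : ContDiffOn ℝ 1 (fun r : ℝ => r ^ γ) (Set.uIcc a b) := fun r hr =>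
    (Real.contDiffAt_rpow_const_of_ne (hsub hr).ne').contDiffWithinAt
  have hac := (hfac.fun_mul hp.absolutelyContinuousOnInterval).const_mul σ
  have hFTC := hac.integral_deriv_eq_sub
  have : 0 ≤ ∫ x in a..b, deriv (fun x => σ * (f x * x ^ γ)) x := by
    apply intervalIntegral.integral_nonneg_of_ae_restrict hab
    rw [EventuallyLE, ae_restrict_iff' measurableSet_Icc]
    filter_upwards [hder, hfac.ae_differentiableAt] with x hx1 hx2 hx3
    rw [← Set.uIcc_of_le hab] at hx3
    have hx0 : 0 < x := hsub hx3
    have hd := (((hx2 hx3).hasDerivAt).mul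
      (Real.hasDerivAt_rpow_const (p := γ) (Or.inl hx0.ne'))).const_mul σ
    have hd' : deriv (fun x => σ * (f x * x ^ γ)) x = _ := hd.deriv
    rw [hd']
    have e : σ * (deriv f x * x ^ γ + f x * (γ * x ^ (γ - 1))) =
        x ^ (γ - 1) * (σ * (x * deriv f x + γ * f x)) := by
      rw [Real.rpow_sub hx0, Real.rpow_one]
      field_simp
    simp only [Pi.zero_apply]
    rw [e]
    exact mul_nonneg (Real.rpow_nonneg hx0.le _) (hx1 hx0)
  linarith

section PointwiseGrowth

variable {f : ℝ → ℝ} {gl gu : ℝ}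

/-- The growth condition makes `f r * r ^ (1 - gu)` nonincreasing and `f r * r ^ (1 - gl)`
nondecreasing; both are compared at `c * r` and `r`. -/
lemma scaling_bounds (hpos : ∀ r : ℝ, 0 < r → 0 < f r)
    (hf : LocallyLipschitzOn (Set.Ioi (0 : ℝ)) f)
    (hgrowth : ∀ᵐ r : ℝ, 0 < r → gl ≤ r * deriv f r / f r + 1 ∧ r * deriv f r / f r + 1 ≤ gu)
    {c r : ℝ} (hc : 0 < c) (hc1 : c ≤ 1) (hr : 0 < r) :
    c ^ gu * (f r * r) ≤ f (c * r) * (c * r) ∧ f (c * r) * (c * r) ≤ c ^ gl * (f r * r) := by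
  have hcr : 0 < c * r := mul_pos hc hr
  have hle : c * r ≤ r := mul_le_of_le_one_left hr.le hc1
  have hmul : ∀ γ : ℝ, c ^ γ * (f r * r) = f r * r ^ (1 - γ) * (c * r) ^ γ := fun γ => by
    rw [Real.mul_rpow hc.le hr.le, Real.rpow_sub hr, Real.rpow_one]
    field_simp
  have hmul' : ∀ γ : ℝ, f (c * r) * (c * r) = f (c * r) * (c * r) ^ (1 - γ) * (c * r) ^ γ :=
    fun γ => by
      rw [mul_assoc, ← Real.rpow_add hcr]
      simp
  constructor
  · rw [hmul, hmul' gu]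
    have := mul_rpow_mono (γ := 1 - gu) (σ := -1) hf (by
      filter_upwards [hgrowth] with t ht ht0
      have h1 := (ht ht0).2
      have h2 := hpos t ht0
      have h3 : t * deriv f t / f t ≤ gu - 1 := by linarith
      rw [div_le_iff₀ h2] at h3
      linarith) hcr hle
    have : f r * r ^ (1 - gu) ≤ f (c * r) * (c * r) ^ (1 - gu) := by linarith
    gcongr
  · rw [hmul, hmul' gl]
    have := mul_rpow_mono (γ := 1 - gl) (σ := 1) hf (by
      filter_upwards [hgrowth] with t ht ht0
      have h1 := (ht ht0).1
      have h2 := hpos t ht0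
      have h3 : gl - 1 ≤ t * deriv f t / f t := by linarith
      rw [le_div_iff₀ h2] at h3
      linarith) hcr hle
    have : f (c * r) * (c * r) ^ (1 - gl) ≤ f r * r ^ (1 - gl) := by linarith
    gcongr

/-- Everything follows from the power scaling of `A`. It is strictly increasing because `c ^ gl < 1`
for `c < 1`, and continuous at `0` by the limit of `r * f r`. Its primitive inherits the scaling by
a change of variables and the tangent inequality by integrating the monotone `A`. -/
lemma growthPair_of_growth (hgl : 0 < gl) (hlu : gl ≤ gu) (hpos : ∀ r : ℝ, 0 < r → 0 < f r)
    (hf : LocallyLipschitzOn (Set.Ioi (0 : ℝ)) f)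
    (hzero : Tendsto (fun r : ℝ => r * f r) (𝓝[>] 0) (𝓝 0))
    (hgrowth : ∀ᵐ r : ℝ, 0 < r → gl ≤ r * deriv f r / f r + 1 ∧ r * deriv f r / f r + 1 ≤ gu) :
    GrowthPair gl gu (fun t => f |t| * t) (fun t => ∫ ρ in (0 : ℝ)..|t|, f ρ * ρ) := by
  set A : ℝ → ℝ := fun t => f |t| * t with hA
  have hodd : ∀ t, A (-t) = -A t := fun t => by simp [hA]
  have hA0 : A 0 = 0 := by simp [hA]
  have hApos : ∀ t, 0 < t → 0 < A t := fun t ht => by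
    simp only [hA, abs_of_pos ht]
    exact mul_pos (hpos t ht) ht
  have hscale : ∀ c r : ℝ, 0 < c → c ≤ 1 → 0 < r →
      c ^ gu * A r ≤ A (c * r) ∧ A (c * r) ≤ c ^ gl * A r := fun c r hc hc1 hr => by
    simp only [hA, abs_of_pos hr, abs_of_pos (mul_pos hc hr)]
    exact scaling_bounds hpos hf hgrowth hc hc1 hr
  have hgu : 0 < gu := hgl.trans_le hlu
  have hmonopos : ∀ x y, 0 < x → x < y → A x < A y := fun x y hx hxy => by
    have hy := hx.trans hxy
    have h1 := (hscale (x / y) y (by positivity) ((div_le_one hy).2 hxy.le) hy).2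
    rw [div_mul_cancel₀ _ hy.ne'] at h1
    have h2 : (x / y) ^ gl < 1 := Real.rpow_lt_one (by positivity) ((div_lt_one hy).2 hxy) hgl
    nlinarith [hApos y hy]
  have hstrict : StrictMono A := by
    have hnn : ∀ x y, 0 ≤ x → x < y → A x < A y := fun x y hx hxy => by
      rcases hx.eq_or_lt with rfl | hx
      · rw [hA0]; exact hApos y hxy
      · exact hmonopos x y hx hxy
    intro x y hxy
    rcases le_or_gt 0 x with hx | hx
    · exact hnn x y hx hxy
    · rcases le_or_gt y 0 with hy | hy
      · have := hnn (-y) (-x) (by linarith) (by linarith)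
        rw [hodd, hodd] at this
        linarith
      · have h1 := hApos y hy
        have h2 := hApos (-x) (by linarith)
        rw [hodd] at h2
        linarith
  have hcontpos : ∀ t, 0 < t → ContinuousAt A t := fun t ht => by
    have h1 : ContinuousAt f t := hf.continuousOn.continuousAt (Ioi_mem_nhds ht)
    have h2 : ContinuousAt (fun t => f |t|) t := by
      apply ContinuousAt.comp (f := fun t : ℝ => |t|)
      · rwa [abs_of_pos ht]
      · fun_prop
    exact h2.mul continuousAt_id
  have hright : Tendsto A (𝓝[>] 0) (𝓝 0) := by
    refine hzero.congr' ?_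
    filter_upwards [self_mem_nhdsWithin] with t ht
    have ht : 0 < t := ht
    simp [hA, abs_of_pos ht, mul_comm]
  have hcont : Continuous A := by
    rw [continuous_iff_continuousAt]
    intro t
    rcases lt_trichotomy t 0 with ht | rfl | ht
    · have h1 := hcontpos (-t) (by linarith)
      have h2 : A = fun t => -A (-t) := by
        funext t; rw [hodd]; ring
      rw [h2]
      exact (ContinuousAt.comp (f := fun t : ℝ => -t) h1 (by fun_prop)).neg
    · have hleft : Tendsto A (𝓝[<] 0) (𝓝 0) := by
        have h2 : A = fun t => -A (-t) := by
          funext t; rw [hodd]; ring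
        have h3 : Tendsto (fun t : ℝ => -t) (𝓝[<] 0) (𝓝[>] 0) := by
          simpa using tendsto_neg_nhdsLT (a := (0 : ℝ))
        rw [h2]
        simpa using (hright.comp h3).neg
      rw [continuousAt_iff_continuous_left'_right']
      exact ⟨by simpa [ContinuousWithinAt, hA0] using hleft,
        by simpa [ContinuousWithinAt, hA0] using hright⟩
    · exact hcontpos t ht
  have hint : ∀ a b, IntervalIntegrable A volume a b := fun a b => hcont.intervalIntegrable a b
  have hHabs : ∀ t, 0 ≤ t → ∫ ρ in (0 : ℝ)..t, f ρ * ρ = ∫ ρ in (0 : ℝ)..t, A ρ := fun t ht => by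
    apply intervalIntegral.integral_congr
    intro ρ hρ
    rw [Set.uIcc_of_le ht] at hρ
    simp [hA, abs_of_nonneg hρ.1]
  have hH : ∀ t, ∫ ρ in (0 : ℝ)..|t|, f ρ * ρ = ∫ ρ in (0 : ℝ)..t, A ρ := fun t => by
    rw [hHabs _ (abs_nonneg t)]
    rcases le_total 0 t with ht | ht
    · rw [abs_of_nonneg ht]
    · rw [abs_of_nonpos ht]
      have := intervalIntegral.integral_comp_neg (f := A) (a := t) (b := 0)
      rw [neg_zero] at this
      rw [← this, intervalIntegral.integral_symm, ← intervalIntegral.integral_neg]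
      exact intervalIntegral.integral_congr fun x _ => by simp [hodd]
  have hup : ∀ c r : ℝ, 1 ≤ c → 0 ≤ r → A (c * r) ≤ c ^ gu * A r := fun c r hc hr => by
    rcases hr.eq_or_lt with rfl | hr
    · simp [hA0]
    have hc0 : 0 < c := by linarith
    -- The lower scaling bound for the factor `c⁻¹ ≤ 1` at the point `c * r`, inverted.
    have h1 := (hscale c⁻¹ (c * r) (by positivity) (inv_le_one_of_one_le₀ hc) (by positivity)).1
    rw [inv_mul_cancel_left₀ hc0.ne', Real.inv_rpow hc0.le] at h1
    have h2 : 0 < c ^ gu := by positivity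
    rwa [inv_mul_le_iff₀ h2] at h1
  have hdown : ∀ c r : ℝ, 0 ≤ c → c ≤ 1 → 0 ≤ r → A (c * r) ≤ c ^ gl * A r :=
      fun c r hc hc1 hr => by
    rcases hr.eq_or_lt with rfl | hr
    · simp [hA0]
    rcases hc.eq_or_lt with rfl | hc
    · simp [hA0, Real.zero_rpow hgl.ne']
    exact (hscale c r hc hc1 hr).2
  have hHscale : ∀ c t γ : ℝ, 0 ≤ c → 0 < γ → (∀ r, 0 ≤ r → A (c * r) ≤ c ^ γ * A r) →
      ∫ ρ in (0 : ℝ)..|c * t|, f ρ * ρ ≤ c ^ (γ + 1) * ∫ ρ in (0 : ℝ)..|t|, f ρ * ρ :=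
      fun c t γ hc hγ hs => by
    rw [hHabs _ (abs_nonneg _), hHabs _ (abs_nonneg _), abs_mul, abs_of_nonneg hc]
    have h1 := intervalIntegral.mul_integral_comp_mul_left (f := A) (a := 0) (b := |t|) (c := c)
    rw [mul_zero] at h1
    rw [← h1]
    have h2 : c ^ (γ + 1) = c * c ^ γ := by
      rcases hc.eq_or_lt with rfl | hc
      · rw [Real.zero_rpow (by linarith), zero_mul]
      · rw [Real.rpow_add hc, Real.rpow_one, mul_comm]
    rw [h2, mul_assoc]
    apply mul_le_mul_of_nonneg_left _ hc
    rw [← intervalIntegral.integral_const_mul]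
    apply intervalIntegral.integral_mono_on (abs_nonneg t)
    · exact Continuous.intervalIntegrable (by fun_prop) _ _
    · exact Continuous.intervalIntegrable (by fun_prop) _ _
    · exact fun r hr => hs r hr.1
  refine ⟨hgl, hlu, by simp, fun t => by simp, hodd, hstrict, hcont, fun x y => ?_, hdown,
    fun c t hc => hHscale c t gu (by linarith) hgu fun r hr => hup c r hc hr,
    fun c t hc hc1 => hHscale c t gl hc hgl fun r hr => hdown c r hc hc1 hr⟩
  simp only [hH]
  rw [intervalIntegral.integral_interval_sub_left (hint _ _) (hint _ _)]
  rcases le_total y x with hxy | hxy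
  · have := intervalIntegral.integral_mono_on (f := fun _ => A y) (g := A) hxy
      (by simp) (hint _ _) fun t ht => hstrict.monotone ht.1
    rw [intervalIntegral.integral_const, smul_eq_mul] at this
    linarith
  · have := intervalIntegral.integral_mono_on (f := A) (g := fun _ => A y) hxy
      (hint _ _) (by simp) fun t ht => hstrict.monotone ht.2
    rw [intervalIntegral.integral_const, smul_eq_mul] at this
    rw [intervalIntegral.integral_symm]
    linarith

lemma GrowthPair.mul_const {A H : ℝ → ℝ} (h : GrowthPair gl gu A H) {k : ℝ} (hk : 0 < k) :
    GrowthPair gl gu (fun t => A t * k) (fun t => H t * k) where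
  gl_pos := h.gl_pos
  gl_le_gu := h.gl_le_gu
  zero := by simp [h.zero]
  even t := by simp [h.even]
  odd t := by simp [h.odd]
  strictMono := fun x y hxy => mul_lt_mul_of_pos_right (h.strictMono hxy) hk
  continuous := h.continuous.mul continuous_const
  tangent x y := by
    have := mul_le_mul_of_nonneg_right (h.tangent x y) hk.le
    linarith
  scale c r hc hc1 hr := by
    have := mul_le_mul_of_nonneg_right (h.scale c r hc hc1 hr) hk.le
    linarith
  scale_up c t hc := by
    have := mul_le_mul_of_nonneg_right (h.scale_up c t hc) hk.le
    linarith
  scale_down c t hc hc1 := by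
    have := mul_le_mul_of_nonneg_right (h.scale_down c t hc hc1) hk.le
    linarith

end PointwiseGrowth

/-! ### Families of functions of controlled growth on a measure space -/

/-- A measurable family of functions of controlled growth. -/
structure GrowthFamily {P : Type*} [MeasurableSpace P] (μ : Measure P) (gl gu : ℝ)
    (A H : P → ℝ → ℝ) : Prop where
  pair : ∀ᵐ p ∂μ, GrowthPair gl gu (A p) (H p)
  aemeasurable_deriv : ∀ f : P → ℝ, AEMeasurable f μ → AEMeasurable (fun p => A p (f p)) μ
  aemeasurable : ∀ f : P → ℝ, AEMeasurable f μ → AEMeasurable (fun p => H p (f p)) μ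

/-- Measurable functions of finite modular. -/
def FiniteMod {P : Type*} [MeasurableSpace P] (μ : Measure P) (H : P → ℝ → ℝ) (f : P → ℝ) : Prop :=
  AEMeasurable f μ ∧ Integrable (fun p => H p (f p)) μ

namespace GrowthFamily

variable {P : Type*} [MeasurableSpace P] {μ : Measure P} {gl gu : ℝ} {A H : P → ℝ → ℝ}

lemma finiteMod_iff (h : GrowthFamily μ gl gu A H) {f : P → ℝ} (hf : AEMeasurable f μ) :
    FiniteMod μ H f ↔ ∫⁻ p, ENNReal.ofReal (H p (f p)) ∂μ < ∞ := by
  have hnn : 0 ≤ᵐ[μ] fun p => H p (f p) := by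
    filter_upwards [h.pair] with p hp using hp.nonneg _
  have := hasFiniteIntegral_iff_ofReal hnn
  rw [← this]
  exact ⟨fun H => H.2.2, fun H' => ⟨hf, (h.aemeasurable f hf).aestronglyMeasurable, H'⟩⟩

lemma ofReal_integral (h : GrowthFamily μ gl gu A H) {f : P → ℝ} (hf : FiniteMod μ H f) :
    ENNReal.ofReal (∫ p, H p (f p) ∂μ) = ∫⁻ p, ENNReal.ofReal (H p (f p)) ∂μ :=
  ofReal_integral_eq_lintegral_ofReal hf.2 <| by
    filter_upwards [h.pair] with p hp using hp.nonneg _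

lemma integral_nonneg (h : GrowthFamily μ gl gu A H) (f : P → ℝ) : 0 ≤ ∫ p, H p (f p) ∂μ :=
  integral_nonneg_of_ae <| by filter_upwards [h.pair] with p hp using hp.nonneg _

lemma toReal_lintegral (h : GrowthFamily μ gl gu A H) {f : P → ℝ} (hf : FiniteMod μ H f) :
    (∫⁻ p, ENNReal.ofReal (H p (f p)) ∂μ).toReal = ∫ p, H p (f p) ∂μ := by
  rw [← h.ofReal_integral hf, ENNReal.toReal_ofReal (h.integral_nonneg f)]

lemma finiteMod_of_le (h : GrowthFamily μ gl gu A H) {f e : P → ℝ} (hf : AEMeasurable f μ)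
    (he : Integrable e μ) (hle : ∀ᵐ p ∂μ, H p (f p) ≤ e p) : FiniteMod μ H f := by
  refine ⟨hf, he.mono' (h.aemeasurable f hf).aestronglyMeasurable ?_⟩
  filter_upwards [h.pair, hle] with p hp hp'
  rwa [Real.norm_of_nonneg (hp.nonneg _)]

lemma finiteMod_add (h : GrowthFamily μ gl gu A H) {f e : P → ℝ} (hf : FiniteMod μ H f)
    (he : FiniteMod μ H e) : FiniteMod μ H fun p => f p + e p :=
  h.finiteMod_of_le (hf.1.add he.1) ((hf.2.add he.2).const_mul (2 ^ (gu + 1))) <| by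
    filter_upwards [h.pair] with p hp using hp.add_le _ _

lemma finiteMod_smul (h : GrowthFamily μ gl gu A H) {f : P → ℝ} (hf : FiniteMod μ H f) (c : ℝ) :
    FiniteMod μ H fun p => c * f p := by
  refine h.finiteMod_of_le (hf.1.const_mul c) (hf.2.const_mul ((max 1 |c|) ^ (gu + 1))) ?_
  filter_upwards [h.pair] with p hp
  refine le_trans ?_ (hp.scale_up _ _ (le_max_left _ _))
  apply hp.mono_abs
  rw [abs_mul, abs_mul]
  exact mul_le_mul_of_nonneg_right ((le_max_right _ _).trans (le_abs_self _)) (abs_nonneg _)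

lemma finiteMod_sub (h : GrowthFamily μ gl gu A H) {f e : P → ℝ} (hf : FiniteMod μ H f)
    (he : FiniteMod μ H e) : FiniteMod μ H fun p => f p - e p := by
  have := h.finiteMod_add hf (h.finiteMod_smul he (-1))
  refine this.imp ?_ ?_ <;> intro h' <;> convert h' using 2 <;> ring_nf

lemma integral_add_le (h : GrowthFamily μ gl gu A H) {f e : P → ℝ} (hf : FiniteMod μ H f)
    (he : FiniteMod μ H e) : ∫ p, H p (f p + e p) ∂μ ≤
      2 ^ (gu + 1) * (∫ p, H p (f p) ∂μ + ∫ p, H p (e p) ∂μ) := by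
  rw [← integral_add hf.2 he.2, ← integral_const_mul]
  apply integral_mono_ae (h.finiteMod_add hf he).2 ((hf.2.add he.2).const_mul _)
  filter_upwards [h.pair] with p hp using hp.add_le _ _

lemma integral_scale_up (h : GrowthFamily μ gl gu A H) {f : P → ℝ} (hf : FiniteMod μ H f) {c : ℝ}
    (hc : 1 ≤ c) : ∫ p, H p (c * f p) ∂μ ≤ c ^ (gu + 1) * ∫ p, H p (f p) ∂μ := by
  rw [← integral_const_mul]
  apply integral_mono_ae (h.finiteMod_smul hf c).2 (hf.2.const_mul _)
  filter_upwards [h.pair] with p hp using hp.scale_up _ _ hc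

lemma integral_scale_down (h : GrowthFamily μ gl gu A H) {f : P → ℝ} (hf : FiniteMod μ H f) {c : ℝ}
    (hc0 : 0 ≤ c) (hc : c ≤ 1) : ∫ p, H p (c * f p) ∂μ ≤ c ^ (gl + 1) * ∫ p, H p (f p) ∂μ := by
  rw [← integral_const_mul]
  apply integral_mono_ae (h.finiteMod_smul hf c).2 (hf.2.const_mul _)
  filter_upwards [h.pair] with p hp using hp.scale_down _ _ hc0 hc

lemma integrable_deriv_mul (h : GrowthFamily μ gl gu A H) {f e : P → ℝ} (hf : FiniteMod μ H f)
    (he : FiniteMod μ H e) : Integrable (fun p => A p (f p) * e p) μ := by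
  refine ((hf.2.add he.2).const_mul (2 ^ (gu + 1))).mono'
    ((h.aemeasurable_deriv f hf.1).mul he.1).aestronglyMeasurable ?_
  filter_upwards [h.pair] with p hp using hp.abs_deriv_mul_le _ _

lemma integral_tangent (h : GrowthFamily μ gl gu A H) {f e : P → ℝ} (hf : FiniteMod μ H f)
    (he : FiniteMod μ H e) : ∫ p, A p (f p) * (e p - f p) ∂μ ≤
      ∫ p, H p (e p) ∂μ - ∫ p, H p (f p) ∂μ := by
  rw [← integral_sub he.2 hf.2]
  apply integral_mono_ae (h.integrable_deriv_mul hf (h.finiteMod_sub he hf)) (he.2.sub hf.2)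
  filter_upwards [h.pair] with p hp using hp.tangent _ _

/-- The pointwise inequality can be integrated because its constant depends only on the exponents
and `ε`, not on the point `p`. -/
lemma exists_uniform_convexity_const (hgl : 0 < gl) (h : GrowthFamily μ gl gu A H) {ε : ℝ}
    (hε : 0 < ε) : ∃ C : ℝ, 0 ≤ C ∧ ∀ f e : P → ℝ, FiniteMod μ H f → FiniteMod μ H e →
      ∫ p, H p (f p - e p) ∂μ ≤
        C * ((∫ p, H p (f p) ∂μ + ∫ p, H p (e p) ∂μ) / 2 - ∫ p, H p ((1 / 2) * (f p + e p)) ∂μ) +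
          ε * (∫ p, H p (f p) ∂μ + ∫ p, H p (e p) ∂μ) := by
  obtain ⟨C, hC0, hC⟩ := FracObstacle.exists_uniform_convexity_const gl gu hgl hε
  refine ⟨C, hC0, fun f e hf he => ?_⟩
  have hm := h.finiteMod_smul (h.finiteMod_add hf he) (1 / 2)
  have i1 : Integrable (fun p => (H p (f p) + H p (e p)) / 2 - H p ((1 / 2) * (f p + e p))) μ :=
    ((hf.2.add he.2).div_const 2).sub hm.2
  have i2 : Integrable (fun p => H p (f p) + H p (e p)) μ := hf.2.add he.2
  have i3 : Integrable (fun p => (H p (f p) + H p (e p)) / 2) μ := i2.div_const 2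
  rw [← integral_add hf.2 he.2, ← integral_div, ← integral_sub i3 hm.2, ← integral_const_mul,
    ← integral_const_mul, ← integral_add (i1.const_mul C) (i2.const_mul ε)]
  apply integral_mono_ae (h.finiteMod_sub hf he).2 ((i1.const_mul C).add (i2.const_mul ε))
  filter_upwards [h.pair] with p hp
  have := hC _ _ hp (f p) (e p)
  rwa [show (f p + e p) / 2 = 1 / 2 * (f p + e p) by ring] at this

/-- If the modulars of a sequence decay geometrically, then the sequence tends to `0` a.e. -/
lemma ae_tendsto_zero (h : GrowthFamily μ gl gu A H) {f : ℕ → P → ℝ}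
    (hf : ∀ n, FiniteMod μ H (f n)) (hle : ∀ n, ∫ p, H p (f n p) ∂μ ≤ (1 / 2) ^ n) :
    ∀ᵐ p ∂μ, Tendsto (fun n => f n p) atTop (𝓝 0) := by
  have hm : ∀ n, AEMeasurable (fun p => ENNReal.ofReal (H p (f n p))) μ := fun n =>
    (h.aemeasurable _ (hf n).1).ennreal_ofReal
  -- The series of modulars converges, so the series of the `H p (f n p)` is finite a.e. and its
  -- terms tend to `0`. Positivity and monotonicity of `H p` then give `f n p → 0`.
  have hsum : ∫⁻ p, ∑' n, ENNReal.ofReal (H p (f n p)) ∂μ ≠ ∞ := by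
    rw [lintegral_tsum hm]
    have : ∀ n, ∫⁻ p, ENNReal.ofReal (H p (f n p)) ∂μ ≤ ENNReal.ofReal ((1 / 2) ^ n) := fun n => by
      rw [← h.ofReal_integral (hf n)]
      exact ENNReal.ofReal_le_ofReal (hle n)
    refine ne_top_of_le_ne_top ?_ (ENNReal.tsum_le_tsum this)
    rw [← ENNReal.ofReal_tsum_of_nonneg (fun n => by positivity) summable_geometric_two]
    exact ENNReal.ofReal_ne_top
  filter_upwards [ae_lt_top' (AEMeasurable.tsum hm) hsum, h.pair] with p hp hp'
  have h1 := ENNReal.tendsto_atTop_zero_of_tsum_ne_top hp.ne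
  have h2 : Tendsto (fun n => H p (f n p)) atTop (𝓝 0) := by
    have := (ENNReal.tendsto_toReal ENNReal.zero_ne_top).comp h1
    simpa [Function.comp_def, ENNReal.toReal_ofReal (hp'.nonneg _)] using this
  rw [Metric.tendsto_atTop]
  intro ε hε
  have h3 : ∀ᶠ n in atTop, H p (f n p) < H p ε := h2.eventually_lt_const (hp'.pos hε.ne')
  obtain ⟨N, hN⟩ := eventually_atTop.1 h3
  refine ⟨N, fun n hn => ?_⟩
  rw [dist_zero_right, Real.norm_eq_abs]
  by_contra hcon
  push Not at hcon
  have := hp'.mono_abs (a := ε) (b := f n p) (by rwa [abs_of_pos hε])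
  exact absurd (hN n hn) (not_lt.2 this)

/-- Fatou's lemma for the modular. -/
lemma finiteMod_of_tendsto (h : GrowthFamily μ gl gu A H) {f : ℕ → P → ℝ} {f' : P → ℝ}
    (hf : ∀ n, FiniteMod μ H (f n)) {C : ℝ} (hC : ∀ᶠ n in atTop, ∫ p, H p (f n p) ∂μ ≤ C)
    (hlim : ∀ᵐ p ∂μ, Tendsto (fun n => f n p) atTop (𝓝 (f' p))) :
    FiniteMod μ H f' ∧ ∫ p, H p (f' p) ∂μ ≤ C := by
  have hf' : AEMeasurable f' μ := aemeasurable_of_tendsto_metrizable_ae _ (fun n => (hf n).1) hlim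
  have hC0 : 0 ≤ C := by
    obtain ⟨n, hn⟩ := hC.exists
    exact (h.integral_nonneg _).trans hn
  have key : ∫⁻ p, ENNReal.ofReal (H p (f' p)) ∂μ ≤ ENNReal.ofReal C := by
    calc ∫⁻ p, ENNReal.ofReal (H p (f' p)) ∂μ
        ≤ ∫⁻ p, liminf (fun n => ENNReal.ofReal (H p (f n p))) atTop ∂μ := by
          apply lintegral_mono_ae
          filter_upwards [h.pair, hlim] with p hp hp'
          have h1 := (hp.continuous_primitive.tendsto (f' p)).comp hp'
          exact (ENNReal.tendsto_ofReal h1).liminf_eq.ge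
      _ ≤ liminf (fun n => ∫⁻ p, ENNReal.ofReal (H p (f n p)) ∂μ) atTop :=
          lintegral_liminf_le' fun n => (h.aemeasurable _ (hf n).1).ennreal_ofReal
      _ ≤ ENNReal.ofReal C := by
          apply liminf_le_of_le (by isBoundedDefault)
          intro b hb
          obtain ⟨n, hn1, hn2⟩ := (hb.and hC).exists
          refine hn1.trans ?_
          rw [← h.ofReal_integral (hf n)]
          exact ENNReal.ofReal_le_ofReal hn2
  have hfin := (h.finiteMod_iff hf').2 (key.trans_lt ENNReal.ofReal_lt_top)
  refine ⟨hfin, ?_⟩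
  rw [← h.ofReal_integral hfin] at key
  exact (ENNReal.ofReal_le_ofReal_iff hC0).1 key

/-- Dominated convergence in modular: `fₙ → f` in modular, `|Tₙ| ≤ |fₙ|` and `Tₙ → T` a.e. imply
`Tₙ → T` in modular. -/
lemma tendsto_integral_sub (h : GrowthFamily μ gl gu A H) {f T : ℕ → P → ℝ} {f' T' : P → ℝ}
    (hf' : FiniteMod μ H f') (hf : ∀ n, FiniteMod μ H (f n))
    (hconv : Tendsto (fun n => ∫ p, H p (f n p - f' p) ∂μ) atTop (𝓝 0))
    (hT : ∀ n, AEMeasurable (T n) μ) (hT' : AEMeasurable T' μ)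
    (hTf : ∀ n, ∀ᵐ p ∂μ, |T n p| ≤ |f n p|) (hTf' : ∀ᵐ p ∂μ, |T' p| ≤ |f' p|)
    (hlim : ∀ᵐ p ∂μ, Tendsto (fun n => T n p) atTop (𝓝 (T' p))) :
    Tendsto (fun n => ∫ p, H p (T n p - T' p) ∂μ) atTop (𝓝 0) := by
  set D : ℝ := 2 ^ (gu + 1) with hD
  have hD0 : 0 < D := by positivity
  have hTfin : ∀ n, FiniteMod μ H (T n) := fun n => h.finiteMod_of_le (hT n) (hf n).2 <| by
    filter_upwards [h.pair, hTf n] with p hp hp' using hp.mono_abs hp'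
  have hTfin' : FiniteMod μ H T' := h.finiteMod_of_le hT' hf'.2 <| by
    filter_upwards [h.pair, hTf'] with p hp hp' using hp.mono_abs hp'
  have hsub := fun n => h.finiteMod_sub (hTfin n) hTfin'
  have hfsub := fun n => h.finiteMod_sub (hf n) hf'
  -- `K` is the part of the bound that does not depend on `n`. The truncated integrand `min (H p (T
  -- n p - T' p)) (K p)` is handled by dominated convergence, and the excess over `K` is at most `D
  -- * D * H p (f n p - f' p)`, whose integral tends to `0`.
  set K : P → ℝ := fun p => (D * D + D) * H p (f' p) with hK
  have hKi : Integrable K μ := hf'.2.const_mul _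
  have hbound : ∀ n, ∀ᵐ p ∂μ, H p (T n p - T' p) ≤ D * D * H p (f n p - f' p) + K p := fun n => by
    filter_upwards [h.pair, hTf n, hTf'] with p hp h1 h2
    have e1 := hp.sub_le (T n p) (T' p)
    have e2 := hp.mono_abs h1
    have e3 := hp.mono_abs h2
    have e4 := hp.add_le (f n p - f' p) (f' p)
    rw [sub_add_cancel] at e4
    have e5 : D * (H p (T n p) + H p (T' p)) ≤
        D * (D * (H p (f n p - f' p) + H p (f' p)) + H p (f' p)) := by
      gcongr
      linarith
    calc _ ≤ _ := e1
      _ ≤ _ := e5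
      _ = _ := by simp only [hK]; ring
  have hmin : Tendsto (fun n => ∫ p, min (H p (T n p - T' p)) (K p) ∂μ) atTop (𝓝 0) := by
    rw [← integral_zero P ℝ (μ := μ)]
    refine tendsto_integral_of_dominated_convergence K
      (fun n => (hsub n).2.aestronglyMeasurable.inf hKi.aestronglyMeasurable) hKi (fun n => ?_) ?_
    · filter_upwards [h.pair] with p hp
      have hK0 : 0 ≤ K p := mul_nonneg (by positivity) (hp.nonneg _)
      rw [Real.norm_of_nonneg (le_min (hp.nonneg _) hK0)]
      exact min_le_right _ _
    · filter_upwards [h.pair, hlim] with p hp hp'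
      have hK0 : 0 ≤ K p := mul_nonneg (by positivity) (hp.nonneg _)
      have h1 : Tendsto (fun n => T n p - T' p) atTop (𝓝 0) := by
        simpa using hp'.sub_const (T' p)
      have h2 := (hp.continuous_primitive.tendsto 0).comp h1
      rw [hp.zero] at h2
      have h3 := h2.min (tendsto_const_nhds (x := K p))
      rwa [min_eq_left hK0] at h3
  have hle : ∀ n, ∫ p, H p (T n p - T' p) ∂μ ≤
      ∫ p, min (H p (T n p - T' p)) (K p) ∂μ + D * D * ∫ p, H p (f n p - f' p) ∂μ := fun n => by
    have hi : Integrable (fun p => min (H p (T n p - T' p)) (K p)) μ := (hsub n).2.inf hKi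
    rw [← integral_const_mul, ← integral_add hi ((hfsub n).2.const_mul _)]
    apply integral_mono_ae (hsub n).2 (hi.add ((hfsub n).2.const_mul _))
    filter_upwards [hbound n, h.pair] with p h1 hp
    have h2 : 0 ≤ D * D * H p (f n p - f' p) := mul_nonneg (by positivity) (hp.nonneg _)
    simp only [Pi.add_apply]
    rcases min_choice (H p (T n p - T' p)) (K p) with h3 | h3 <;> rw [h3] <;> linarith
  refine squeeze_zero (fun n => h.integral_nonneg _) hle ?_
  simpa using hmin.add (hconv.const_mul (D * D))

/-- The derivative of the modular along a line is continuous at the starting point. -/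
lemma tendsto_integral_deriv (h : GrowthFamily μ gl gu A H) {f e : P → ℝ} (hf : FiniteMod μ H f)
    (he : FiniteMod μ H e) {t : ℕ → ℝ} (ht1 : ∀ n, |t n| ≤ 1) (ht : Tendsto t atTop (𝓝 0)) :
    Tendsto (fun n => ∫ p, A p (f p + t n * e p) * e p ∂μ) atTop
      (𝓝 (∫ p, A p (f p) * e p ∂μ)) := by
  set D : ℝ := 2 ^ (gu + 1) with hD
  have hD0 : 0 < D := by positivity
  refine tendsto_integral_of_dominated_convergence
    (fun p => D * (D * (H p (f p) + H p (e p)) + H p (e p))) (fun n => ?_) ?_ (fun n => ?_) ?_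
  · exact (h.integrable_deriv_mul (h.finiteMod_add hf (h.finiteMod_smul he (t n)))
      he).aestronglyMeasurable
  · exact (((hf.2.add he.2).const_mul D).add he.2).const_mul D
  · filter_upwards [h.pair] with p hp
    rw [Real.norm_eq_abs]
    refine (hp.abs_deriv_mul_le _ _).trans ?_
    have h1 := hp.add_le (f p) (t n * e p)
    have h2 : H p (t n * e p) ≤ H p (e p) := by
      apply hp.mono_abs
      rw [abs_mul]
      exact mul_le_of_le_one_left (abs_nonneg _) (ht1 n)
    have h3 : D * (H p (f p) + H p (t n * e p)) ≤ D * (H p (f p) + H p (e p)) := by gcongr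
    gcongr
    linarith
  · filter_upwards [h.pair] with p hp
    have h1 : Tendsto (fun n => f p + t n * e p) atTop (𝓝 (f p)) := by
      simpa using tendsto_const_nhds.add (ht.mul_const (e p))
    exact ((hp.continuous.tendsto _).comp h1).mul_const _

end GrowthFamily

/-! ### Measurability -/

section Measurability

variable {d : ℕ} {g : Rd d → Rd d → ℝ → ℝ} {gl gu : ℝ}

/-- A jointly measurable version of `g(x, y, eᵗ)`. -/
lemma IsAdmissible.exists_measurable_version (hg : IsAdmissible g gl gu) :
    ∃ b : Rd d × Rd d → ℝ → ℝ, Measurable (Function.uncurry b) ∧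
      ∀ᵐ p : Rd d × Rd d, ∀ t, b p t = g p.1 p.2 (Real.exp t) := by
  classical
  have hm : ∀ t : ℝ, AEMeasurable (fun p : Rd d × Rd d => g p.1 p.2 (Real.exp t)) volume :=
    fun t => hg.measurable _ (Real.exp_pos t)
  set S : Set (Rd d × Rd d) := {p | (∀ q : ℚ, g p.1 p.2 (Real.exp q) = (hm q).mk _ p) ∧
    LocallyLipschitzOn (Set.Ioi (0 : ℝ)) (g p.1 p.2)} with hS
  have hSae : ∀ᵐ p : Rd d × Rd d, p ∈ S := by
    have h1 : ∀ᵐ p : Rd d × Rd d, ∀ q : ℚ, g p.1 p.2 (Real.exp q) = (hm q).mk _ p :=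
      ae_all_iff.2 fun q => (hm q).ae_eq_mk
    filter_upwards [h1, hg.lipschitz] with p hp1 hp2 using ⟨hp1, hp2⟩
  -- `S` itself need not be measurable, so its complement is enlarged to a measurable null set.
  set N := toMeasurable volume Sᶜ with hN
  have hNm : MeasurableSet N := measurableSet_toMeasurable _ _
  have hN0 : volume N = 0 := by rw [hN, measure_toMeasurable]; exact hSae
  have hNS : ∀ p, p ∉ N → p ∈ S := fun p hp => by
    by_contra h
    exact hp (subset_toMeasurable _ _ h)
  set b : Rd d × Rd d → ℝ → ℝ := fun p t => if p ∈ N then 0 else g p.1 p.2 (Real.exp t) with hb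
  have hcont : ∀ p, Continuous (b p) := fun p => by
    by_cases hp : p ∈ N
    · simp only [hb, hp, if_true]
      exact continuous_const
    · simp only [hb, hp, if_false]
      exact (hNS p hp).2.continuousOn.comp_continuous Real.continuous_exp fun t => Real.exp_pos t
  have hmeasq : ∀ q : ℚ, Measurable fun p => b p q := fun q => by
    have : (fun p => b p q) = fun p => if p ∈ N then 0 else (hm q).mk _ p := by
      funext p
      by_cases hp : p ∈ N
      · simp [hb, hp]
      · simp only [hb, hp, if_false]
        exact (hNS p hp).1 q
    rw [this]
    exact Measurable.ite hNm measurable_const (hm q).measurable_mk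
  -- Continuity in `t` carries measurability from rational to real `t`, and a function continuous in
  -- one variable and measurable in the other is jointly measurable.
  have hmeas : ∀ t : ℝ, Measurable fun p => b p t := fun t => by
    obtain ⟨q, -, -, hq⟩ := Real.exists_seq_rat_strictMono_tendsto t
    exact measurable_of_tendsto_metrizable (fun n => hmeasq (q n))
      (tendsto_pi_nhds.2 fun p => ((hcont p).tendsto t).comp hq)
  refine ⟨b, ?_, ?_⟩
  · have := measurable_uncurry_of_continuous_of_measurable (u := fun t p => b p t) hcont hmeas
    exact this.comp measurable_swap
  · have : ∀ᵐ p : Rd d × Rd d, p ∉ N := measure_eq_zero_iff_ae_notMem.1 hN0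
    filter_upwards [this] with p hp t
    simp [hb, hp]

lemma IsAdmissible.aemeasurable_comp_mul (hg : IsAdmissible g gl gu) {f : Rd d × Rd d → ℝ}
    (hf : AEMeasurable f volume) :
    AEMeasurable (fun p : Rd d × Rd d => g p.1 p.2 |f p| * f p) volume := by
  obtain ⟨b, hb, hbg⟩ := hg.exists_measurable_version
  have h1 : AEMeasurable (fun p => b p (Real.log |f p|) * f p) volume := by
    have : AEMeasurable (fun p => (p, Real.log |f p|)) volume :=
      aemeasurable_id.prodMk (Real.measurable_log.comp_aemeasurable hf.abs)
    exact (hb.comp_aemeasurable this).mul hf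
  refine h1.congr ?_
  filter_upwards [hbg] with p hp
  rcases eq_or_ne (f p) 0 with h0 | h0
  -- Here `Real.log 0` is a default value without meaning, but the factor `f p = 0` removes it.
  · simp [h0]
  · rw [hp, Real.exp_log (abs_pos.2 h0)]

/-- Cutting off by the indicator of `0 < ρ ≤ |f p|` turns the variable interval into all of `ℝ`, so
that measurability of parametric integrals applies to a jointly measurable integrand. -/
lemma IsAdmissible.aemeasurable_primitiveG (hg : IsAdmissible g gl gu) {f : Rd d × Rd d → ℝ}
    (hf : AEMeasurable f volume) :
    AEMeasurable (fun p : Rd d × Rd d => primitiveG g p.1 p.2 |f p|) volume := by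
  obtain ⟨b, hb, hbg⟩ := hg.exists_measurable_version
  have hmk := hf.measurable_mk
  set T : Set ((Rd d × Rd d) × ℝ) := {z | 0 < z.2 ∧ z.2 ≤ |hf.mk f z.1|}
  set F : (Rd d × Rd d) × ℝ → ℝ := T.indicator fun z => b z.1 (Real.log z.2) * z.2 with hF
  have hFm : Measurable F := by
    apply Measurable.indicator
    · have : Measurable fun z : (Rd d × Rd d) × ℝ => b z.1 (Real.log z.2) :=
        hb.comp (measurable_fst.prodMk (Real.measurable_log.comp measurable_snd))
      exact this.mul measurable_snd
    · have h2 : Measurable fun z : (Rd d × Rd d) × ℝ => |hf.mk f z.1| :=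
        (hmk.comp measurable_fst).abs
      exact (measurableSet_lt measurable_const measurable_snd).inter
        (measurableSet_le measurable_snd h2)
  have h1 : StronglyMeasurable fun p : Rd d × Rd d => ∫ ρ : ℝ, F (p, ρ) :=
    hFm.stronglyMeasurable.integral_prod_right'
  refine ⟨_, h1.measurable, ?_⟩
  filter_upwards [hbg, hf.ae_eq_mk] with p hp hfp
  rw [primitiveG, hfp, intervalIntegral.integral_of_le (abs_nonneg _),
    ← integral_indicator measurableSet_Ioc]
  congr 1
  funext ρ
  by_cases hρ : 0 < ρ ∧ ρ ≤ |hf.mk f p|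
  · rw [Set.indicator_of_mem (show ρ ∈ Set.Ioc 0 _ from hρ), hF,
      Set.indicator_of_mem (show (p, ρ) ∈ T from hρ), hp, Real.exp_log hρ.1]
  · rw [Set.indicator_of_notMem (show ρ ∉ Set.Ioc 0 _ from hρ), hF,
      Set.indicator_of_notMem (show (p, ρ) ∉ T from hρ)]

/-- `g(x, y, |t|) t / |x - y|ᵈ`. -/
noncomputable def weightedDeriv (g : Rd d → Rd d → ℝ → ℝ) (p : Rd d × Rd d) (t : ℝ) : ℝ :=
  g p.1 p.2 |t| * t / ‖p.1 - p.2‖ ^ d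

/-- `G(x, y, |t|) / |x - y|ᵈ`. -/
noncomputable def weightedPrimitive (g : Rd d → Rd d → ℝ → ℝ) (p : Rd d × Rd d) (t : ℝ) : ℝ :=
  primitiveG g p.1 p.2 |t| / ‖p.1 - p.2‖ ^ d

lemma ae_fst_ne_snd (hd : 0 < d) : ∀ᵐ p : Rd d × Rd d, p.1 ≠ p.2 := by
  have : NeZero d := ⟨hd.ne'⟩
  have hm : MeasurableSet {p : Rd d × Rd d | p.1 ≠ p.2} :=
    (measurableSet_eq_fun measurable_fst measurable_snd).compl
  rw [Measure.volume_eq_prod, Measure.ae_prod_iff_ae_ae hm]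
  refine Eventually.of_forall fun x => ?_
  filter_upwards [measure_eq_zero_iff_ae_notMem.1 (measure_singleton (μ := volume) x)] with y hy h
  exact hy h.symm

lemma IsAdmissible.growthFamily (hg : IsAdmissible g gl gu) (hd : 0 < d) :
    GrowthFamily volume gl gu (weightedDeriv g) (weightedPrimitive g) where
  pair := by
    filter_upwards [hg.pos, hg.lipschitz, hg.tendsto_zero, hg.growth, ae_fst_ne_snd hd]
      with p h1 h2 h3 h4 h5
    have hk : 0 < (‖p.1 - p.2‖ ^ d)⁻¹ := by
      have := norm_pos_iff.2 (sub_ne_zero.2 h5)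
      positivity
    exact (growthPair_of_growth hg.gl_pos hg.gl_le_gu h1 h2 h3 h4).mul_const hk
  aemeasurable_deriv f hf := by
    have : Measurable fun p : Rd d × Rd d => ‖p.1 - p.2‖ ^ d :=
      Continuous.measurable (by fun_prop)
    exact (hg.aemeasurable_comp_mul hf).div this.aemeasurable
  aemeasurable f hf := by
    have : Measurable fun p : Rd d × Rd d => ‖p.1 - p.2‖ ^ d :=
      Continuous.measurable (by fun_prop)
    exact (hg.aemeasurable_primitiveG hf).div this.aemeasurable

end Measurability

/-! ### The space `W_0^{s,G}(Ω)` -/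

section Space

variable {d : ℕ} {g : Rd d → Rd d → ℝ → ℝ} {gl gu s : ℝ} {Ω : Set (Rd d)}

/-- The difference quotient as a function on pairs. -/
noncomputable def quot (s : ℝ) (u : Rd d → ℝ) (p : Rd d × Rd d) : ℝ := fracDiff s u p.1 p.2

/-- The modular as a real number. -/
noncomputable def modInt (g : Rd d → Rd d → ℝ → ℝ) (s : ℝ) (u : Rd d → ℝ) : ℝ :=
  ∫ p, weightedPrimitive g p (quot s u p)

/-- Functions whose difference quotient is measurable and has finite modular. -/
def FinMod (g : Rd d → Rd d → ℝ → ℝ) (s : ℝ) (u : Rd d → ℝ) : Prop :=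
  FiniteMod volume (weightedPrimitive g) (quot s u)

lemma quot_add (u v : Rd d → ℝ) : quot s (u + v) = fun p => quot s u p + quot s v p := by
  funext p
  simp only [quot, fracDiff, Pi.add_apply]
  ring

lemma quot_sub (u v : Rd d → ℝ) : quot s (u - v) = fun p => quot s u p - quot s v p := by
  funext p
  simp only [quot, fracDiff, Pi.sub_apply]
  ring

lemma quot_smul (c : ℝ) (u : Rd d → ℝ) : quot s (c • u) = fun p => c * quot s u p := by
  funext p
  simp only [quot, fracDiff, Pi.smul_apply, smul_eq_mul]
  ring

lemma abs_quot_comp_le {T : ℝ → ℝ} (hT : ∀ a b, |T a - T b| ≤ |a - b|) (u : Rd d → ℝ)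
    (p : Rd d × Rd d) : |quot s (fun x => T (u x)) p| ≤ |quot s u p| := by
  simp only [quot, fracDiff, abs_div]
  exact div_le_div_of_nonneg_right (hT _ _) (abs_nonneg _)

lemma aemeasurable_quot {u : Rd d → ℝ} (hu : AEMeasurable u volume) :
    AEMeasurable (quot s u) volume := by
  have h1 : AEMeasurable (fun p : Rd d × Rd d => u p.1) volume :=
    hu.comp_quasiMeasurePreserving Measure.quasiMeasurePreserving_fst
  have h2 : AEMeasurable (fun p : Rd d × Rd d => u p.2) volume :=
    hu.comp_quasiMeasurePreserving Measure.quasiMeasurePreserving_snd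
  have h3 : Measurable fun p : Rd d × Rd d => ‖p.1 - p.2‖ ^ s :=
    (Continuous.measurable (by fun_prop : Continuous fun p : Rd d × Rd d => ‖p.1 - p.2‖)).pow_const s
  exact (h1.sub h2).div h3.aemeasurable

lemma ae_tendsto_quot {v : ℕ → Rd d → ℝ} {u : Rd d → ℝ}
    (h : ∀ᵐ x, Tendsto (fun n => v n x) atTop (𝓝 (u x))) :
    ∀ᵐ p : Rd d × Rd d, Tendsto (fun n => quot s (v n) p) atTop (𝓝 (quot s u p)) := by
  have h1 : ∀ᵐ p : Rd d × Rd d, Tendsto (fun n => v n p.1) atTop (𝓝 (u p.1)) :=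
    Measure.quasiMeasurePreserving_fst.ae h
  have h2 : ∀ᵐ p : Rd d × Rd d, Tendsto (fun n => v n p.2) atTop (𝓝 (u p.2)) :=
    Measure.quasiMeasurePreserving_snd.ae h
  filter_upwards [h1, h2] with p hp1 hp2 using (hp1.sub hp2).div_const _

/-- A property of almost all pairs holds for some exterior point and almost every point. -/
lemma exists_exterior_ae (hd : 0 < d) (hΩb : Bornology.IsBounded Ω) {Q : Rd d × Rd d → Prop}
    (h : ∀ᵐ p, Q p) : ∃ y, y ∉ Ω ∧ ∀ᵐ x, Q (y, x) := by
  have : NeZero d := ⟨hd.ne'⟩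
  have : Nonempty (Fin d) := ⟨⟨0, hd⟩⟩
  rw [Measure.volume_eq_prod] at h
  have h1 := Measure.ae_ae_of_ae_prod h
  by_contra hcon
  have h2 : ∀ᵐ y : Rd d, y ∈ Ω := by
    filter_upwards [h1] with y hy
    by_contra hyΩ
    exact hcon ⟨y, hyΩ, hy⟩
  have h3 : volume (Set.univ : Set (Rd d)) ≤ volume Ω := by
    apply measure_mono_ae
    filter_upwards [h2] with y hy _ using hy
  have h4 : volume Ω < ∞ := hΩb.measure_lt_top
  -- Otherwise the bounded set `Ω` would have full, hence infinite, measure.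
  rw [measure_univ_of_isAddLeftInvariant] at h3
  exact absurd (h3.trans_lt h4) (lt_irrefl _)

/-- Pairing with an exterior point recovers the function from its difference quotient. This replaces
a Poincaré inequality wherever information on quotients is transferred to functions. -/
lemma eq_neg_quot_mul (hs : 0 < s) {w : Rd d → ℝ} (hw : ∀ x, x ∉ Ω → w x = 0) {y : Rd d}
    (hy : y ∉ Ω) (x : Rd d) : w x = -quot s w (y, x) * ‖y - x‖ ^ s := by
  simp only [quot, fracDiff, hw y hy, zero_sub]
  rcases eq_or_ne y x with rfl | hyx
  · simp [hw y hy, Real.zero_rpow hs.ne']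
  · have : 0 < ‖y - x‖ ^ s := Real.rpow_pos_of_pos (norm_pos_iff.2 (sub_ne_zero.2 hyx)) _
    field_simp

lemma ae_eq_zero_of_quot (hd : 0 < d) (hs : 0 < s) (hΩb : Bornology.IsBounded Ω) {w : Rd d → ℝ}
    (hw : ∀ x, x ∉ Ω → w x = 0) (h : ∀ᵐ p, quot s w p = 0) : ∀ᵐ x, w x = 0 := by
  obtain ⟨y, hy, hyx⟩ := exists_exterior_ae hd hΩb h
  filter_upwards [hyx] with x hx
  rw [eq_neg_quot_mul hs hw hy x, hx]
  simp

lemma opIntegrand_eq (u v : Rd d → ℝ) :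
    opIntegrand g s u v = fun p => weightedDeriv g p (quot s u p) * quot s v p := by
  funext p
  simp only [opIntegrand, weightedDeriv, quot]
  ring

lemma opL_eq (u v : Rd d → ℝ) :
    opL g s u v = ∫ p, weightedDeriv g p (quot s u p) * quot s v p := by
  rw [opL, opIntegrand_eq]

variable (hg : IsAdmissible g gl gu) (hd : 0 < d)
include hg hd

lemma finMod_iff {u : Rd d → ℝ} (hu : AEMeasurable u volume) :
    FinMod g s u ↔ modular g s u < ∞ :=
  (hg.growthFamily hd).finiteMod_iff (aemeasurable_quot hu)

lemma modular_eq_ofReal {u : Rd d → ℝ} (hu : FinMod g s u) :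
    modular g s u = ENNReal.ofReal (modInt g s u) :=
  ((hg.growthFamily hd).ofReal_integral hu).symm

lemma modInt_nonneg (u : Rd d → ℝ) : 0 ≤ modInt g s u := (hg.growthFamily hd).integral_nonneg _

lemma toReal_modular {u : Rd d → ℝ} (hu : FinMod g s u) :
    (modular g s u).toReal = modInt g s u := (hg.growthFamily hd).toReal_lintegral hu

lemma FinMod.add {u v : Rd d → ℝ} (hu : FinMod g s u) (hv : FinMod g s v) :
    FinMod g s (u + v) := by
  rw [FinMod, quot_add]
  exact (hg.growthFamily hd).finiteMod_add hu hv

lemma FinMod.sub {u v : Rd d → ℝ} (hu : FinMod g s u) (hv : FinMod g s v) :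
    FinMod g s (u - v) := by
  rw [FinMod, quot_sub]
  exact (hg.growthFamily hd).finiteMod_sub hu hv

lemma FinMod.smul (c : ℝ) {u : Rd d → ℝ} (hu : FinMod g s u) : FinMod g s (c • u) := by
  rw [FinMod, quot_smul]
  exact (hg.growthFamily hd).finiteMod_smul hu c

lemma modInt_add_le {u v : Rd d → ℝ} (hu : FinMod g s u) (hv : FinMod g s v) :
    modInt g s (u + v) ≤ 2 ^ (gu + 1) * (modInt g s u + modInt g s v) := by
  rw [modInt, quot_add]
  exact (hg.growthFamily hd).integral_add_le hu hv

lemma modInt_smul_le_up {u : Rd d → ℝ} (hu : FinMod g s u) {c : ℝ} (hc : 1 ≤ c) :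
    modInt g s (c • u) ≤ c ^ (gu + 1) * modInt g s u := by
  rw [modInt, quot_smul]
  exact (hg.growthFamily hd).integral_scale_up hu hc

lemma modInt_smul_le_down {u : Rd d → ℝ} (hu : FinMod g s u) {c : ℝ} (hc0 : 0 ≤ c) (hc : c ≤ 1) :
    modInt g s (c • u) ≤ c ^ (gl + 1) * modInt g s u := by
  rw [modInt, quot_smul]
  exact (hg.growthFamily hd).integral_scale_down hu hc0 hc

lemma modInt_sub_comm (u v : Rd d → ℝ) : modInt g s (u - v) = modInt g s (v - u) := by
  apply integral_congr_ae
  filter_upwards [(hg.growthFamily hd).pair] with p hp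
  rw [← hp.even, quot_sub, quot_sub]
  ring_nf

/-! ### Luxemburg norm and modular -/

lemma luxemburg_le {u : Rd d → ℝ} (hu : FinMod g s u) {t : ℝ} (ht : 0 < t)
    (h : modInt g s (t⁻¹ • u) ≤ 1) : luxemburg g s u ≤ ENNReal.ofReal t := by
  refine iInf₂_le t ⟨ht, ?_⟩
  have : (fun x => u x / t) = t⁻¹ • u := by
    funext x; simp [div_eq_inv_mul]
  rw [this, modular_eq_ofReal hg hd (hu.smul hg hd _)]
  exact ENNReal.ofReal_le_one.2 h

/-- Dividing by `t ≤ 1` multiplies the modular by at most `t ^ (-(gu + 1))`; for `t ≥ 1`, in the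
companion lemma, the exponent is `gl + 1` instead. -/
lemma luxemburg_le_of_small {u : Rd d → ℝ} (hu : FinMod g s u) {t : ℝ} (ht : 0 < t) (ht1 : t ≤ 1)
    (h : modInt g s u ≤ t ^ (gu + 1)) : luxemburg g s u ≤ ENNReal.ofReal t := by
  apply luxemburg_le hg hd hu ht
  have h1 := modInt_smul_le_up hg hd hu (one_le_inv₀ ht |>.2 ht1)
  have h2 : 0 < t ^ (gu + 1) := by positivity
  rw [Real.inv_rpow ht.le, ← div_eq_inv_mul] at h1
  exact h1.trans ((div_le_one h2).2 h)

lemma luxemburg_le_of_large {u : Rd d → ℝ} (hu : FinMod g s u) {t : ℝ} (ht : 1 ≤ t)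
    (h : modInt g s u ≤ t ^ (gl + 1)) : luxemburg g s u ≤ ENNReal.ofReal t := by
  have ht0 : 0 < t := by linarith
  apply luxemburg_le hg hd hu ht0
  have h1 := modInt_smul_le_down hg hd hu (inv_nonneg.2 ht0.le) (inv_le_one_of_one_le₀ ht)
  have h2 : 0 < t ^ (gl + 1) := by positivity
  rw [Real.inv_rpow ht0.le, ← div_eq_inv_mul] at h1
  exact h1.trans ((div_le_one h2).2 h)

/-- Some `t < ε ≤ 1` is admissible in the infimum, and rescaling `t⁻¹ • u` by `t` leaves a modular
of at most `t ^ (gl + 1) ≤ t`. -/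
lemma modInt_lt_of_luxemburg_lt {u : Rd d → ℝ} (hu : AEMeasurable u volume) {ε : ℝ} (hε1 : ε ≤ 1)
    (h : luxemburg g s u < ENNReal.ofReal ε) : FinMod g s u ∧ modInt g s u < ε := by
  simp only [luxemburg, iInf_lt_iff] at h
  obtain ⟨t, ⟨ht, hmod⟩, htε⟩ := h
  have htε' : t < ε := (ENNReal.ofReal_lt_ofReal_iff_of_nonneg ht.le).1 htε
  have e1 : (fun x => u x / t) = t⁻¹ • u := by
    funext x; simp [div_eq_inv_mul]
  rw [e1] at hmod
  have hfin : FinMod g s (t⁻¹ • u) :=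
    (finMod_iff hg hd (hu.const_smul _)).2 (hmod.trans_lt ENNReal.one_lt_top)
  rw [modular_eq_ofReal hg hd hfin, ENNReal.ofReal_le_one] at hmod
  have e2 : u = t • (t⁻¹ • u) := by rw [smul_inv_smul₀ ht.ne']
  have hfin' : FinMod g s u := by rw [e2]; exact hfin.smul hg hd t
  refine ⟨hfin', ?_⟩
  have h1 := modInt_smul_le_down hg hd hfin ht.le (by linarith : t ≤ 1)
  rw [← e2] at h1
  have h2 : t ^ (gl + 1) ≤ t ^ (1 : ℝ) :=
    Real.rpow_le_rpow_of_exponent_ge ht (by linarith) (by linarith [hg.gl_pos])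
  rw [Real.rpow_one] at h2
  have h3 : t ^ (gl + 1) * modInt g s (t⁻¹ • u) ≤ t ^ (gl + 1) * 1 := by gcongr
  linarith

omit hg hd in
lemma IsTestFunction.aemeasurable {φ : Rd d → ℝ} (hφ : IsTestFunction Ω φ) :
    AEMeasurable φ volume := hφ.1.continuous.measurable.aemeasurable

omit hg hd in
lemma IsTestFunction.eq_zero {φ : Rd d → ℝ} (hφ : IsTestFunction Ω φ) (x : Rd d) (hx : x ∉ Ω) :
    φ x = 0 := by
  by_contra h
  exact hx (hφ.2.2 (subset_tsupport _ h))

/-- Membership in the space in terms of the modular. -/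
lemma mem_W0_iff {u : Rd d → ℝ} : u ∈ W0 g s Ω ↔
    AEMeasurable u volume ∧ (∀ x, x ∉ Ω → u x = 0) ∧ FinMod g s u ∧
      ∀ ε : ℝ, 0 < ε → ∃ φ, IsTestFunction Ω φ ∧ FinMod g s (u - φ) ∧ modInt g s (u - φ) < ε := by
  constructor
  · rintro ⟨h1, h2, h3, h4⟩
    refine ⟨h1, h2, (finMod_iff hg hd h1).2 h3, fun ε hε => ?_⟩
    obtain ⟨φ, hφ, hlux⟩ := h4 (min ε 1) (lt_min hε one_pos)
    obtain ⟨h5, h6⟩ := modInt_lt_of_luxemburg_lt hg hd (h1.sub hφ.aemeasurable)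
      (min_le_right ε 1) hlux
    exact ⟨φ, hφ, h5, h6.trans_le (min_le_left _ _)⟩
  · rintro ⟨h1, h2, h3, h4⟩
    refine ⟨h1, h2, (finMod_iff hg hd h1).1 h3, fun ε hε => ?_⟩
    set t := min ε 1 / 2 with ht
    have hm : 0 < min ε 1 := lt_min hε one_pos
    have ht0 : 0 < t := by positivity
    have hm1 := min_le_right ε 1
    have hmε := min_le_left ε 1
    obtain ⟨φ, hφ, h5, h6⟩ := h4 (t ^ (gu + 1)) (by positivity)
    refine ⟨φ, hφ, (luxemburg_le_of_small hg hd h5 ht0 (by linarith) h6.le).trans_lt ?_⟩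
    exact (ENNReal.ofReal_lt_ofReal_iff hε).2 (by linarith)

/-! ### Linear structure and completeness -/

lemma W0.finMod {u : Rd d → ℝ} (hu : u ∈ W0 g s Ω) : FinMod g s u :=
  ((mem_W0_iff hg hd).1 hu).2.2.1

lemma W0.add_mem {u v : Rd d → ℝ} (hu : u ∈ W0 g s Ω) (hv : v ∈ W0 g s Ω) : u + v ∈ W0 g s Ω := by
  rw [mem_W0_iff hg hd] at hu hv ⊢
  obtain ⟨a1, a2, a3, a4⟩ := hu
  obtain ⟨b1, b2, b3, b4⟩ := hv
  refine ⟨a1.add b1, fun x hx => by simp [a2 x hx, b2 x hx], a3.add hg hd b3, fun ε hε => ?_⟩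
  have hD : (0 : ℝ) < 2 ^ (gu + 1) := by positivity
  obtain ⟨φ, hφ, c1, c2⟩ := a4 (ε / (2 * 2 ^ (gu + 1))) (by positivity)
  obtain ⟨ψ, hψ, e1, e2⟩ := b4 (ε / (2 * 2 ^ (gu + 1))) (by positivity)
  have hsum : u + v - (φ + ψ) = (u - φ) + (v - ψ) := by abel
  refine ⟨φ + ψ, ⟨hφ.1.add hψ.1, hφ.2.1.add hψ.2.1,
    (tsupport_add φ ψ).trans (Set.union_subset hφ.2.2 hψ.2.2)⟩, ?_, ?_⟩
  · rw [hsum]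
    exact c1.add hg hd e1
  · rw [hsum]
    refine (modInt_add_le hg hd c1 e1).trans_lt ?_
    calc _ < 2 ^ (gu + 1) * (ε / (2 * 2 ^ (gu + 1)) + ε / (2 * 2 ^ (gu + 1))) := by gcongr
      _ = ε := by field_simp; ring

lemma W0.smul_mem (c : ℝ) {u : Rd d → ℝ} (hu : u ∈ W0 g s Ω) : c • u ∈ W0 g s Ω := by
  rw [mem_W0_iff hg hd] at hu ⊢
  obtain ⟨a1, a2, a3, a4⟩ := hu
  refine ⟨a1.const_smul c, fun x hx => by simp [a2 x hx], a3.smul hg hd c, fun ε hε => ?_⟩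
  set m := max 1 |c| with hm
  have hm1 : 1 ≤ m := le_max_left _ _
  have hm0 : 0 < m := by linarith
  have hmp : 0 < m ^ (gu + 1) := by positivity
  obtain ⟨φ, hφ, c1, c2⟩ := a4 (ε / m ^ (gu + 1)) (by positivity)
  have hsub : c • u - c • φ = c • (u - φ) := (smul_sub _ _ _).symm
  refine ⟨c • φ, ⟨hφ.1.const_smul c, hφ.2.1.smul_left (f := fun _ => c),
    (tsupport_smul_subset_right (fun _ => c) φ).trans hφ.2.2⟩, ?_, ?_⟩
  · rw [hsub]
    exact c1.smul hg hd c
  · rw [hsub]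
    have h1 : modInt g s (c • (u - φ)) ≤ modInt g s (m • (u - φ)) := by
      apply integral_mono_ae (c1.smul hg hd c).2 (c1.smul hg hd m).2
      filter_upwards [(hg.growthFamily hd).pair] with p hp
      apply hp.mono_abs
      rw [quot_smul, quot_smul, abs_mul, abs_mul]
      exact mul_le_mul_of_nonneg_right ((le_max_right _ _).trans (le_abs_self _)) (abs_nonneg _)
    refine (h1.trans (modInt_smul_le_up hg hd c1 hm1)).trans_lt ?_
    rw [mul_comm]
    exact (lt_div_iff₀ hmp).1 c2

lemma W0.sub_mem {u v : Rd d → ℝ} (hu : u ∈ W0 g s Ω) (hv : v ∈ W0 g s Ω) :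
    u - v ∈ W0 g s Ω := by
  have := W0.add_mem hg hd hu (W0.smul_mem hg hd (-1) hv)
  rwa [neg_one_smul, ← sub_eq_add_neg] at this

/-- The space is complete with respect to convergence in modular. -/
lemma W0.complete (hs : 0 < s) (hΩ : IsOpen Ω) (hΩb : Bornology.IsBounded Ω) {v : ℕ → Rd d → ℝ}
    (hv : ∀ n, v n ∈ W0 g s Ω)
    (hC : ∀ τ : ℝ, 0 < τ → ∃ N, ∀ n ≥ N, ∀ m ≥ N, modInt g s (v n - v m) ≤ τ) :
    ∃ u ∈ W0 g s Ω, (∃ k : ℕ → ℕ, StrictMono k ∧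
      ∀ᵐ x, Tendsto (fun n => v (k n) x) atTop (𝓝 (u x))) ∧
      Tendsto (fun n => modInt g s (v n - u)) atTop (𝓝 0) := by
  have hfam := hg.growthFamily hd
  -- The threshold is chosen so that `2 ^ n` times the `n`-th increment has modular at most `(1 / 2)
  -- ^ n`. These multiples tend to `0` a.e., so the quotients of the increments are eventually below
  -- `(1 / 2) ^ n` and are summable.
  obtain ⟨k, hk, hkP⟩ := extraction_forall_of_eventually'
    (P := fun n k => ∀ m ≥ k, modInt g s (v m - v k) ≤ (1 / 2) ^ n / (2 ^ n) ^ (gu + 1))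
    (fun n => by
      obtain ⟨N, hN⟩ := hC ((1 / 2) ^ n / (2 ^ n) ^ (gu + 1)) (by positivity)
      exact ⟨N, fun k hk m hm => hN m (hk.trans hm) k hk⟩)
  have hfin : ∀ n m, FinMod g s (v n - v m) := fun n m =>
    (W0.finMod hg hd (hv n)).sub hg hd (W0.finMod hg hd (hv m))
  have hae := hfam.ae_tendsto_zero
    (f := fun n => quot s ((2 : ℝ) ^ n • (v (k (n + 1)) - v (k n))))
    (fun n => (hfin _ _).smul hg hd _) fun n => by
      refine (modInt_smul_le_up hg hd (hfin _ _) (one_le_pow₀ one_le_two)).trans ?_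
      have h1 := hkP n _ (hk.monotone n.le_succ)
      have h2 : (0 : ℝ) < (2 ^ n) ^ (gu + 1) := by positivity
      rwa [le_div_iff₀ h2, mul_comm] at h1
  have hconv : ∀ᵐ p : Rd d × Rd d, ∃ l, Tendsto (fun n => quot s (v (k n)) p) atTop (𝓝 l) := by
    filter_upwards [hae] with p hp
    apply cauchySeq_tendsto_of_complete
    apply cauchySeq_of_summable_dist
    refine Summable.of_norm_bounded_eventually_nat summable_geometric_two ?_
    have h1 := (tendsto_zero_iff_norm_tendsto_zero.1 hp).eventually_lt_const one_pos
    filter_upwards [h1] with n hn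
    rw [quot_smul, quot_sub, norm_mul, norm_pow, Real.norm_ofNat] at hn
    rw [Real.norm_of_nonneg dist_nonneg, dist_comm, Real.dist_eq]
    rw [Real.norm_eq_abs] at hn
    rw [one_div, inv_pow, ← one_div, le_div_iff₀ (by positivity), mul_comm]
    exact hn.le
  have hconvx : ∀ᵐ x, ∃ l, Tendsto (fun n => v (k n) x) atTop (𝓝 l) := by
    obtain ⟨y, hy, hyx⟩ := exists_exterior_ae hd hΩb hconv
    filter_upwards [hyx] with x ⟨l, hl⟩
    refine ⟨-l * ‖y - x‖ ^ s, ?_⟩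
    simp only [fun n => eq_neg_quot_mul hs (hv (k n)).2.1 hy x]
    exact hl.neg.mul_const _
  obtain ⟨f, hf, hflim⟩ := measurable_limit_of_tendsto_metrizable_ae
    (fun n => (hv (k n)).1) hconvx
  -- The a.e. limit `f` is set to zero outside `Ω`, since the space requires this at every exterior
  -- point.
  set u : Rd d → ℝ := Ω.indicator f with hu
  have hulim : ∀ᵐ x, Tendsto (fun n => v (k n) x) atTop (𝓝 (u x)) := by
    filter_upwards [hflim] with x hx
    by_cases hxΩ : x ∈ Ω
    · simpa [hu, hxΩ] using hx
    · simp [hu, hxΩ, (hv _).2.1 x hxΩ]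
  -- Fatou's lemma along the subsequence, with `n` fixed, turns the Cauchy bound into a bound on the
  -- distance to the limit.
  have hclose : ∀ τ : ℝ, 0 < τ → ∃ N, ∀ n ≥ N, FinMod g s (v n - u) ∧ modInt g s (v n - u) ≤ τ := by
    intro τ hτ
    obtain ⟨N, hN⟩ := hC τ hτ
    refine ⟨N, fun n hn => ?_⟩
    refine hfam.finiteMod_of_tendsto (f := fun m => quot s (v n - v (k m)))
      (fun m => hfin _ _) ?_ ?_
    · filter_upwards [eventually_ge_atTop N] with m hm
      exact hN n hn _ (hm.trans (hk.id_le m))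
    · apply ae_tendsto_quot
      filter_upwards [hulim] with x hx using hx.const_sub _
  have hlim : Tendsto (fun n => modInt g s (v n - u)) atTop (𝓝 0) := by
    rw [Metric.tendsto_atTop]
    intro ε hε
    obtain ⟨N, hN⟩ := hclose (ε / 2) (by positivity)
    refine ⟨N, fun n hn => ?_⟩
    rw [dist_zero_right, Real.norm_of_nonneg (modInt_nonneg hg hd _)]
    linarith [(hN n hn).2]
  have hufin : FinMod g s u := by
    obtain ⟨N, hN⟩ := hclose 1 one_pos
    have := (W0.finMod hg hd (hv N)).sub hg hd (hN N le_rfl).1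
    rwa [sub_sub_cancel] at this
  refine ⟨u, ?_, ⟨k, hk, hulim⟩, hlim⟩
  rw [mem_W0_iff hg hd]
  refine ⟨(hf.indicator hΩ.measurableSet).aemeasurable, fun x hx => by simp [hu, hx], hufin,
    fun ε hε => ?_⟩
  have hD : (0 : ℝ) < 2 ^ (gu + 1) := by positivity
  obtain ⟨N, hN⟩ := hclose (ε / (2 * 2 ^ (gu + 1))) (by positivity)
  obtain ⟨hN1, hN2⟩ := hN N le_rfl
  obtain ⟨φ, hφ, e1, e2⟩ := ((mem_W0_iff hg hd).1 (hv N)).2.2.2 (ε / (2 * 2 ^ (gu + 1)))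
    (by positivity)
  have hsum : u - φ = (u - v N) + (v N - φ) := by abel
  have hN1' : FinMod g s (u - v N) := hufin.sub hg hd (W0.finMod hg hd (hv N))
  rw [modInt_sub_comm hg hd] at hN2
  refine ⟨φ, hφ, ?_, ?_⟩
  · rw [hsum]
    exact hN1'.add hg hd e1
  · rw [hsum]
    refine (modInt_add_le hg hd hN1' e1).trans_lt ?_
    calc _ ≤ 2 ^ (gu + 1) * (ε / (2 * 2 ^ (gu + 1)) + modInt g s (v N - φ)) := by gcongr
      _ < 2 ^ (gu + 1) * (ε / (2 * 2 ^ (gu + 1)) + ε / (2 * 2 ^ (gu + 1))) := by gcongr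
      _ = ε := by field_simp; ring

end Space

/-! ### Truncations -/

/-- A smooth approximation of `t ↦ (t - k)⁺` that vanishes at `0`. -/
noncomputable def smoothTrunc (k ε t : ℝ) : ℝ :=
  (√((t - k) ^ 2 + ε ^ 2) + t - √(k ^ 2 + ε ^ 2)) / 2

lemma smoothTrunc_zero (k ε : ℝ) : smoothTrunc k ε 0 = 0 := by simp [smoothTrunc]

lemma contDiff_smoothTrunc (k : ℝ) {ε : ℝ} (hε : 0 < ε) :
    ContDiff ℝ (⊤ : ℕ∞) (smoothTrunc k ε) := by
  unfold smoothTrunc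
  have h1 : ContDiff ℝ (⊤ : ℕ∞) fun t : ℝ => √((t - k) ^ 2 + ε ^ 2) :=
    ContDiff.sqrt (by fun_prop) fun t => by positivity
  exact ((h1.add contDiff_id).sub contDiff_const).div_const 2

/-- Up to a constant this is the average of the two 1-Lipschitz functions `√((t - k) ^ 2 + ε ^ 2)`
and `t`. -/
lemma abs_smoothTrunc_sub_le (k : ℝ) {ε : ℝ} (hε : 0 < ε) (a b : ℝ) :
    |smoothTrunc k ε a - smoothTrunc k ε b| ≤ |a - b| := by
  have key : ∀ x y : ℝ, √(x ^ 2 + ε ^ 2) - √(y ^ 2 + ε ^ 2) ≤ |x - y| := fun x y => by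
    have h1 : √(x ^ 2 + ε ^ 2) ≤ √(y ^ 2 + ε ^ 2) + |x - y| := by
      apply Real.sqrt_le_iff.2
      constructor
      · positivity
      · have h2 := Real.sq_sqrt (show 0 ≤ y ^ 2 + ε ^ 2 by positivity)
        have h3 : |y| ≤ √(y ^ 2 + ε ^ 2) := Real.abs_le_sqrt (by nlinarith)
        have h4 : y * (x - y) ≤ √(y ^ 2 + ε ^ 2) * |x - y| := by
          refine (le_abs_self _).trans ?_
          rw [abs_mul]
          gcongr
        have h5 := sq_abs (x - y)
        nlinarith
    linarith
  have h1 := key (a - k) (b - k)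
  have h2 := key (b - k) (a - k)
  rw [sub_sub_sub_cancel_right] at h1 h2
  rw [abs_sub_comm b a] at h2
  have h3 := le_abs_self (a - b)
  have h4 := neg_abs_le (a - b)
  simp only [smoothTrunc]
  rw [abs_le]
  constructor <;> linarith

lemma tendsto_smoothTrunc {k : ℝ} (hk : 0 ≤ k) {ε t : ℕ → ℝ} {l : ℝ}
    (hε : Tendsto ε atTop (𝓝 0)) (ht : Tendsto t atTop (𝓝 l)) :
    Tendsto (fun n => smoothTrunc k (ε n) (t n)) atTop (𝓝 (max (l - k) 0)) := by
  have hc : Continuous fun z : ℝ × ℝ => smoothTrunc k z.1 z.2 := by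
    unfold smoothTrunc
    fun_prop
  have h1 := (hc.tendsto (0, l)).comp (hε.prodMk_nhds ht)
  have h2 : smoothTrunc k 0 l = max (l - k) 0 := by
    simp only [smoothTrunc]
    rw [zero_pow two_ne_zero, add_zero, add_zero, Real.sqrt_sq_eq_abs, Real.sqrt_sq hk]
    rcases le_total (l - k) 0 with h | h
    · rw [max_eq_right h, abs_of_nonpos h]; ring
    · rw [max_eq_left h, abs_of_nonneg h]; ring
  rw [← h2]
  exact h1

lemma abs_max_sub_max_le (k a b : ℝ) : |max (a - k) 0 - max (b - k) 0| ≤ |a - b| := by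
  have := abs_max_sub_max_le_abs (a - k) (b - k) 0
  rwa [sub_sub_sub_cancel_right] at this

/-- The truncations `(w - k)⁺`, `k ≥ 0`, of an element of the space belong to the space. -/
lemma W0.trunc_mem {d : ℕ} {g : Rd d → Rd d → ℝ → ℝ} {gl gu s : ℝ} {Ω : Set (Rd d)}
    (hg : IsAdmissible g gl gu) (hd : 0 < d) (hs : 0 < s) (hΩb : Bornology.IsBounded Ω)
    {w : Rd d → ℝ} (hw : w ∈ W0 g s Ω) {k : ℝ} (hk : 0 ≤ k) :
    (fun x => max (w x - k) 0) ∈ W0 g s Ω := by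
  have hfam := hg.growthFamily hd
  obtain ⟨h1, h2, h3, h4⟩ := (mem_W0_iff hg hd).1 hw
  -- The geometric rate yields a.e. convergence of the quotients without passing to a subsequence.
  choose φ hφ hφfin hφlt using fun n : ℕ => h4 ((1 / 2) ^ n) (by positivity)
  have hquot := hfam.ae_tendsto_zero (f := fun n => quot s (w - φ n)) hφfin fun n => (hφlt n).le
  have hφw : ∀ᵐ x, Tendsto (fun n => φ n x) atTop (𝓝 (w x)) := by
    obtain ⟨y, hy, hyx⟩ := exists_exterior_ae hd hΩb hquot
    filter_upwards [hyx] with x hx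
    have hz : ∀ n, φ n x = w x + quot s (w - φ n) (y, x) * ‖y - x‖ ^ s := fun n => by
      have := eq_neg_quot_mul hs (w := w - φ n)
        (fun x hx => by simp [h2 x hx, (hφ n).eq_zero x hx]) hy x
      simp only [Pi.sub_apply] at this
      linarith
    simp only [hz]
    simpa using (hx.mul_const (‖y - x‖ ^ s)).const_add (w x)
  set ε : ℕ → ℝ := fun n => 1 / ((n : ℝ) + 1) with hε
  have hε0 : ∀ n, 0 < ε n := fun n => Nat.one_div_pos_of_nat
  set ψ : ℕ → Rd d → ℝ := fun n x => smoothTrunc k (ε n) (φ n x) with hψ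
  set T : Rd d → ℝ := fun x => max (w x - k) 0 with hT
  have hψtest : ∀ n, IsTestFunction Ω (ψ n) := fun n =>
    ⟨(contDiff_smoothTrunc k (hε0 n)).comp (hφ n).1,
      (hφ n).2.1.comp_left (smoothTrunc_zero k (ε n)),
      (tsupport_comp_subset (smoothTrunc_zero k (ε n)) (φ n)).trans (hφ n).2.2⟩
  have hφfin' : ∀ n, FinMod g s (φ n) := fun n => by
    have := h3.sub hg hd (hφfin n)
    rwa [sub_sub_cancel] at this
  have hTm : AEMeasurable T volume := (h1.sub_const k).max aemeasurable_const
  have hTfin : FinMod g s T := hfam.finiteMod_of_le (aemeasurable_quot hTm) h3.2 <| by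
    filter_upwards [hfam.pair] with p hp
    exact hp.mono_abs (abs_quot_comp_le (abs_max_sub_max_le k) w p)
  have hψfin : ∀ n, FinMod g s (ψ n) := fun n =>
    hfam.finiteMod_of_le (aemeasurable_quot (hψtest n).aemeasurable) (hφfin' n).2 <| by
      filter_upwards [hfam.pair] with p hp
      exact hp.mono_abs (abs_quot_comp_le (abs_smoothTrunc_sub_le k (hε0 n)) (φ n) p)
  -- Contractions do not increase quotients, so those of `ψ n` are dominated by those of `φ n`,
  -- which converge in modular.
  have hlim : Tendsto (fun n => modInt g s (ψ n - T)) atTop (𝓝 0) := by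
    have := hfam.tendsto_integral_sub (f := fun n => quot s (φ n)) (T := fun n => quot s (ψ n))
      (f' := quot s w) (T' := quot s T) h3 hφfin' ?_
      (fun n => aemeasurable_quot (hψtest n).aemeasurable) (aemeasurable_quot hTm)
      (fun n => Eventually.of_forall
        (abs_quot_comp_le (abs_smoothTrunc_sub_le k (hε0 n)) (φ n)))
      (Eventually.of_forall (abs_quot_comp_le (abs_max_sub_max_le k) w)) ?_
    · simpa only [modInt, quot_sub] using this
    · have h5 : Tendsto (fun n => modInt g s (w - φ n)) atTop (𝓝 0) :=
        squeeze_zero (fun n => modInt_nonneg hg hd _) (fun n => (hφlt n).le)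
          (tendsto_pow_atTop_nhds_zero_of_lt_one (by norm_num) (by norm_num))
      simp only [modInt_sub_comm hg hd w] at h5
      simpa only [modInt, quot_sub] using h5
    · apply ae_tendsto_quot
      filter_upwards [hφw] with x hx
      exact tendsto_smoothTrunc hk tendsto_one_div_add_atTop_nhds_zero_nat hx
  rw [mem_W0_iff hg hd]
  refine ⟨hTm, fun x hx => by simp [hT, h2 x hx, hk], hTfin, fun δ hδ => ?_⟩
  obtain ⟨n, hn⟩ := (hlim.eventually_lt_const hδ).exists
  exact ⟨ψ n, hψtest n, hTfin.sub hg hd (hψfin n), by rwa [modInt_sub_comm hg hd]⟩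

/-! ### The variational problem on convex constraint sets -/

section Variational

variable {d : ℕ} {g : Rd d → Rd d → ℝ → ℝ} {gl gu s : ℝ} {Ω : Set (Rd d)}
  {F : (Rd d → ℝ) → ℝ} {K : Set (Rd d → ℝ)}

/-- Convex subsets of the space that are closed under convergence a.e. -/
structure IsConstraintSet (g : Rd d → Rd d → ℝ → ℝ) (s : ℝ) (Ω : Set (Rd d))
    (K : Set (Rd d → ℝ)) : Prop where
  subset : K ⊆ W0 g s Ω
  segment : ∀ u ∈ K, ∀ v ∈ K, ∀ t : ℝ, 0 ≤ t → t ≤ 1 → u + t • (v - u) ∈ K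
  closed : ∀ v : ℕ → Rd d → ℝ, (∀ n, v n ∈ K) → ∀ u ∈ W0 g s Ω,
    (∀ᵐ x, Tendsto (fun n => v n x) atTop (𝓝 (u x))) → u ∈ K

variable (hg : IsAdmissible g gl gu) (hd : 0 < d)
include hg hd

/-! ### Linear functionals -/

lemma IsDualElement.map_sub (hF : IsDualElement g s Ω F) {u v : Rd d → ℝ} (hu : u ∈ W0 g s Ω)
    (hv : v ∈ W0 g s Ω) : F (u - v) = F u - F v := by
  rw [sub_eq_add_neg, ← neg_one_smul ℝ v, hF.map_add u hu _ (W0.smul_mem hg hd (-1) hv),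
    hF.map_smul _ v hv]
  ring

/-- Boundedness in the Luxemburg norm, expressed through the modular: the range `t ≤ 1` gives
continuity of `F`, the range `t ≥ 1` gives coercivity of the energy. -/
lemma IsDualElement.exists_bound (hF : IsDualElement g s Ω F) : ∃ C : ℝ, 0 ≤ C ∧
    (∀ u ∈ W0 g s Ω, ∀ t : ℝ, 0 < t → t ≤ 1 → modInt g s u ≤ t ^ (gu + 1) → |F u| ≤ C * t) ∧
    (∀ u ∈ W0 g s Ω, ∀ t : ℝ, 1 ≤ t → modInt g s u ≤ t ^ (gl + 1) → |F u| ≤ C * t) := by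
  obtain ⟨C, hC⟩ := hF.bound
  have key : ∀ u ∈ W0 g s Ω, ∀ t : ℝ, 0 < t → luxemburg g s u ≤ ENNReal.ofReal t →
      |F u| ≤ C * t := fun u hu t ht hlux => by
    have h1 : ENNReal.ofReal |F u| ≤ ENNReal.ofReal (C * t) := by
      rw [ENNReal.ofReal_mul (NNReal.coe_nonneg C), ENNReal.ofReal_coe_nnreal]
      exact (hC u hu).trans (by gcongr)
    exact (ENNReal.ofReal_le_ofReal_iff (by positivity)).1 h1
  refine ⟨C, C.2, fun u hu t ht ht1 h => ?_, fun u hu t ht h => ?_⟩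
  · exact key u hu t ht (luxemburg_le_of_small hg hd (W0.finMod hg hd hu) ht ht1 h)
  · exact key u hu t (by linarith) (luxemburg_le_of_large hg hd (W0.finMod hg hd hu) ht h)

lemma IsDualElement.tendsto (hF : IsDualElement g s Ω F) {v : ℕ → Rd d → ℝ} {u : Rd d → ℝ}
    (hv : ∀ n, v n ∈ W0 g s Ω) (hu : u ∈ W0 g s Ω)
    (h : Tendsto (fun n => modInt g s (v n - u)) atTop (𝓝 0)) :
    Tendsto (fun n => F (v n)) atTop (𝓝 (F u)) := by
  obtain ⟨C, hC0, hC, -⟩ := hF.exists_bound hg hd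
  rw [Metric.tendsto_atTop]
  intro ε hε
  set t := min 1 (ε / (C + 1) / 2) with ht
  have ht0 : 0 < t := lt_min one_pos (by positivity)
  obtain ⟨N, hN⟩ := eventually_atTop.1
    (h.eventually_lt_const (show (0 : ℝ) < t ^ (gu + 1) by positivity))
  refine ⟨N, fun n hn => ?_⟩
  rw [Real.dist_eq, ← hF.map_sub hg hd (hv n) hu]
  have h1 := hC _ (W0.sub_mem hg hd (hv n) hu) t ht0 (min_le_left _ _) (hN n hn).le
  have h2 : t ≤ ε / (C + 1) / 2 := min_le_right _ _
  have h3 : C * t ≤ (C + 1) * (ε / (C + 1) / 2) := by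
    gcongr
    linarith
  have h4 : (C + 1) * (ε / (C + 1) / 2) = ε / 2 := by field_simp
  linarith

lemma energy_eq {v : Rd d → ℝ} (hv : v ∈ W0 g s Ω) : energy g s F v = modInt g s v - F v := by
  rw [energy, toReal_modular hg hd (W0.finMod hg hd hv)]

/-- Coercivity of the energy. -/
lemma exists_coercive (hF : IsDualElement g s Ω F) : ∃ κ M : ℝ, 0 < κ ∧
    ∀ v ∈ W0 g s Ω, κ * modInt g s v - M ≤ energy g s F v := by
  obtain ⟨C, hC0, -, hC⟩ := hF.exists_bound hg hd
  have hgl := hg.gl_pos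
  set p := gl + 1 with hp
  have hpq : p.HolderConjugate p.conjExponent := Real.HolderConjugate.conjExponent (by linarith)
  refine ⟨1 - p⁻¹, p⁻¹ + C ^ p.conjExponent / p.conjExponent, ?_, fun v hv => ?_⟩
  · have : p⁻¹ < 1 := inv_lt_one_of_one_lt₀ (by linarith)
    linarith
  have hΓ := modInt_nonneg hg hd (s := s) v
  -- Adding `1` ensures `t ≥ 1`. Young's inequality for `C * t` then costs only the fraction `p⁻¹ <
  -- 1` of the modular.
  set t := (1 + modInt g s v) ^ p⁻¹ with ht
  have htp : t ^ p = 1 + modInt g s v := Real.rpow_inv_rpow (by linarith) (by linarith)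
  have ht1 : 1 ≤ t := Real.one_le_rpow (by linarith) (by positivity)
  have h1 := hC v hv t ht1 (by rw [htp]; linarith)
  have h2 := Real.young_inequality_of_nonneg (show 0 ≤ t by linarith) hC0 hpq
  rw [htp] at h2
  rw [energy_eq hg hd hv]
  have h3 := le_abs_self (F v)
  have h4 : (1 + modInt g s v) / p = p⁻¹ + p⁻¹ * modInt g s v := by ring
  linarith [mul_comm t C]

/-! ### Existence of minimisers -/

lemma exists_isMinimiser (hs : 0 < s) (hΩ : IsOpen Ω) (hΩb : Bornology.IsBounded Ω)
    (hF : IsDualElement g s Ω F) (hK : IsConstraintSet g s Ω K) (hne : K.Nonempty) :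
    ∃ u, IsMinimiser g s K F u := by
  have hfam := hg.growthFamily hd
  obtain ⟨κ, M, hκ, hcoer⟩ := exists_coercive hg hd hF
  have hbdd : BddBelow (energy g s F '' K) := by
    refine ⟨-M, ?_⟩
    rintro _ ⟨v, hv, rfl⟩
    have h1 := hcoer v (hK.subset hv)
    have h2 := mul_nonneg hκ.le (modInt_nonneg hg hd (s := s) v)
    linarith
  set m := sInf (energy g s F '' K) with hm
  have hmle : ∀ v ∈ K, m ≤ energy g s F v := fun v hv => csInf_le hbdd ⟨v, hv, rfl⟩
  have hex : ∀ n : ℕ, ∃ v ∈ K, energy g s F v < m + 1 / ((n : ℝ) + 1) := fun n => by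
    obtain ⟨_, ⟨v, hv, rfl⟩, hlt⟩ := exists_lt_of_csInf_lt (hne.image _)
      (lt_add_of_pos_right m (Nat.one_div_pos_of_nat (α := ℝ) (n := n)))
    exact ⟨v, hv, hlt⟩
  choose v hvK hvlt using hex
  have hvW : ∀ n, v n ∈ W0 g s Ω := fun n => hK.subset (hvK n)
  have hvfin : ∀ n, FinMod g s (v n) := fun n => W0.finMod hg hd (hvW n)
  set B := (m + 1 + M) / κ with hB
  have hbound : ∀ n, modInt g s (v n) ≤ B := fun n => by
    rw [hB, le_div_iff₀ hκ, mul_comm]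
    have h1 := hcoer _ (hvW n)
    have h2 := hvlt n
    have h3 : 1 / ((n : ℝ) + 1) ≤ 1 := by
      rw [div_le_one (by positivity)]
      linarith [n.cast_nonneg (α := ℝ)]
    linarith
  have hB0 : 0 ≤ B := (modInt_nonneg hg hd _).trans (hbound 0)
  have hCauchy : ∀ τ : ℝ, 0 < τ → ∃ N, ∀ n ≥ N, ∀ l ≥ N, modInt g s (v n - v l) ≤ τ := by
    intro τ hτ
    -- The midpoint has energy at least `m` and `F` cancels by linearity, so the convexity gap is at
    -- most `τ / (2 * (C + 1))` for late indices. The constants make each of the two terms at most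
    -- `τ / 2`.
    obtain ⟨C, hC0, hC⟩ := hfam.exists_uniform_convexity_const hg.gl_pos
      (show 0 < τ / (4 * (B + 1)) by positivity)
    obtain ⟨N, hN⟩ := exists_nat_one_div_lt (show 0 < τ / (2 * (C + 1)) by positivity)
    refine ⟨N, fun n hn l hl => ?_⟩
    have h1 := hC _ _ (hvfin n) (hvfin l)
    have hmid : v n + (1 / 2 : ℝ) • (v l - v n) = (1 / 2 : ℝ) • (v n + v l) := by
      funext x
      simp only [Pi.add_apply, Pi.smul_apply, Pi.sub_apply, smul_eq_mul]
      ring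
    have hmidK := hK.segment _ (hvK n) _ (hvK l) (1 / 2) (by norm_num) (by norm_num)
    rw [hmid] at hmidK
    have hmidE := hmle _ hmidK
    rw [energy_eq hg hd (hK.subset hmidK), hF.map_smul _ _ (W0.add_mem hg hd (hvW n) (hvW l)),
      hF.map_add _ (hvW n) _ (hvW l)] at hmidE
    have e1 : ∫ p, weightedPrimitive g p (1 / 2 * (quot s (v n) p + quot s (v l) p)) =
        modInt g s ((1 / 2 : ℝ) • (v n + v l)) := by
      rw [modInt, quot_smul, quot_add]
    have e2 : ∫ p, weightedPrimitive g p (quot s (v n) p - quot s (v l) p) =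
        modInt g s (v n - v l) := by
      rw [modInt, quot_sub]
    rw [e1, e2] at h1
    change modInt g s (v n - v l) ≤ C * ((modInt g s (v n) + modInt g s (v l)) / 2 -
      modInt g s ((1 / 2 : ℝ) • (v n + v l))) +
        τ / (4 * (B + 1)) * (modInt g s (v n) + modInt g s (v l)) at h1
    have hsmall : ∀ j ≥ N, energy g s F (v j) ≤ m + τ / (2 * (C + 1)) := fun j hj => by
      have : 1 / ((j : ℝ) + 1) ≤ 1 / ((N : ℝ) + 1) := by gcongr
      linarith [hvlt j]
    have hn' := hsmall n hn
    have hl' := hsmall l hl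
    rw [energy_eq hg hd (hvW _)] at hn' hl'
    have h2 : C * ((modInt g s (v n) + modInt g s (v l)) / 2 -
        modInt g s ((1 / 2 : ℝ) • (v n + v l))) ≤ (C + 1) * (τ / (2 * (C + 1))) := by
      have : C * ((modInt g s (v n) + modInt g s (v l)) / 2 -
          modInt g s ((1 / 2 : ℝ) • (v n + v l))) ≤ C * (τ / (2 * (C + 1))) := by
        gcongr
        linarith
      refine this.trans ?_
      gcongr
      linarith
    have h3 : τ / (4 * (B + 1)) * (modInt g s (v n) + modInt g s (v l)) ≤
        τ / (4 * (B + 1)) * (2 * (B + 1)) := by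
      gcongr
      linarith [hbound n, hbound l]
    have h4 : (C + 1) * (τ / (2 * (C + 1))) = τ / 2 := by field_simp
    have h5 : τ / (4 * (B + 1)) * (2 * (B + 1)) = τ / 2 := by field_simp; norm_num
    linarith
  obtain ⟨u, huW, ⟨k, hk, hklim⟩, hconv⟩ := W0.complete hg hd hs hΩ hΩb hvW hCauchy
  have huK : u ∈ K := hK.closed (fun n => v (k n)) (fun n => hvK _) u huW hklim
  refine ⟨u, huK, fun w hw => le_trans ?_ (hmle w hw)⟩
  apply le_of_forall_pos_le_add
  intro η hη
  have hFlim := (hF.tendsto hg hd hvW huW hconv).comp hk.tendsto_atTop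
  -- Since `F` converges, the energy bound becomes a bound on the modulars, which Fatou's lemma
  -- passes to the limit.
  have hΓ : ∀ᶠ n in atTop, modInt g s (v (k n)) ≤ m + F u + η := by
    have h1 := hFlim.eventually_lt_const (show F u < F u + η / 2 by linarith)
    have h2 := (tendsto_one_div_add_atTop_nhds_zero_nat (𝕜 := ℝ)).eventually_lt_const
      (half_pos hη)
    filter_upwards [h1, hk.tendsto_atTop.eventually h2] with n hn1 hn2
    have h3 := hvlt (k n)
    rw [energy_eq hg hd (hvW _)] at h3
    simp only [Function.comp_apply] at hn1
    linarith
  have hfat := (hfam.finiteMod_of_tendsto (f := fun n => quot s (v (k n))) (fun n => hvfin _) hΓ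
    (ae_tendsto_quot hklim)).2
  change modInt g s u ≤ _ at hfat
  rw [energy_eq hg hd huW]
  linarith

/-! ### Solutions and minimisers -/

lemma integrable_opIntegrand {u v : Rd d → ℝ} (hu : u ∈ W0 g s Ω) (hv : v ∈ W0 g s Ω) :
    Integrable (opIntegrand g s u v) volume := by
  rw [opIntegrand_eq]
  exact (hg.growthFamily hd).integrable_deriv_mul (W0.finMod hg hd hu) (W0.finMod hg hd hv)

lemma isSolution_iff_isMinimiser (hF : IsDualElement g s Ω F) (hK : IsConstraintSet g s Ω K)
    (u : Rd d → ℝ) : IsSolution g s K F u ↔ IsMinimiser g s K F u := by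
  have hfam := hg.growthFamily hd
  have htangent : ∀ a b : Rd d → ℝ, FinMod g s a → FinMod g s b →
      opL g s a (b - a) ≤ modInt g s b - modInt g s a := fun a b ha hb => by
    rw [opL_eq, quot_sub]
    exact hfam.integral_tangent ha hb
  refine and_congr_right fun huK => ⟨fun h v hv => ?_, fun h v hv => ?_⟩
  · have huW := hK.subset huK
    have hvW := hK.subset hv
    have h1 := htangent u v (W0.finMod hg hd huW) (W0.finMod hg hd hvW)
    have h2 := h v hv
    rw [hF.map_sub hg hd hvW huW] at h2
    rw [energy_eq hg hd huW, energy_eq hg hd hvW]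
    linarith
  · have huW := hK.subset huK
    have heW := W0.sub_mem hg hd (hK.subset hv) huW
    set e := v - u with he
    set t : ℕ → ℝ := fun n => 1 / ((n : ℝ) + 1) with ht
    have ht0 : ∀ n, 0 < t n := fun n => Nat.one_div_pos_of_nat
    have ht1 : ∀ n, t n ≤ 1 := fun n => by
      rw [ht]
      simp only
      rw [div_le_one (by positivity)]
      linarith [n.cast_nonneg (α := ℝ)]
    have hlim := hfam.tendsto_integral_deriv (W0.finMod hg hd huW) (W0.finMod hg hd heW)
      (fun n => by rw [abs_of_pos (ht0 n)]; exact ht1 n)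
      (tendsto_one_div_add_atTop_nhds_zero_nat (𝕜 := ℝ))
    rw [← opL_eq] at hlim
    rw [sub_nonneg]
    refine ge_of_tendsto' hlim fun n => ?_
    have hteW := W0.smul_mem hg hd (t n) heW
    have hmem := hK.segment u huK v hv (t n) (ht0 n).le (ht1 n)
    rw [← he] at hmem
    have hW := hK.subset hmem
    have h1 := h _ hmem
    rw [energy_eq hg hd huW, energy_eq hg hd hW, hF.map_add u huW _ hteW,
      hF.map_smul _ _ heW] at h1
    -- The tangent is taken at the perturbed point: minimality then gives `F e` as a lower bound for
    -- the derivative there, and only continuity of this derivative as `t n → 0` is needed.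
    have h2 := htangent (u + t n • e) u (W0.finMod hg hd hW) (W0.finMod hg hd huW)
    have h3 : u - (u + t n • e) = (-t n) • e := by
      rw [neg_smul]
      abel
    rw [h3, opL_eq, quot_smul, quot_add, quot_smul] at h2
    simp only [mul_left_comm _ (-t n)] at h2
    rw [integral_const_mul] at h2
    have h4 : t n * F e ≤
        t n * ∫ p, weightedDeriv g p (quot s u p + t n * quot s e p) * quot s e p := by
      linarith
    exact le_of_mul_le_mul_left h4 (ht0 n)

/-! ### Comparison -/

omit hg hd in
lemma quot_max_mul_nonneg (w : Rd d → ℝ) (k : ℝ) (p : Rd d × Rd d) :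
    0 ≤ quot s (fun x => max (w x - k) 0) p * quot s w p := by
  simp only [quot, fracDiff]
  rw [div_mul_div_comm]
  apply div_nonneg _ (mul_self_nonneg _)
  rcases le_total (w p.1) (w p.2) with h | h
  · apply mul_nonneg_of_nonpos_of_nonpos <;> rw [sub_nonpos]
    · gcongr
    · exact h
  · apply mul_nonneg <;> rw [sub_nonneg]
    · gcongr
    · exact h

omit hg hd in
-- The hypotheses say that `c` has the sign of `b - a` and vanishes with it. The quotient of a
-- truncation of `u' - u` is such a `c`, so strict monotonicity of `A` can be tested with
-- truncations.
lemma GrowthPair.deriv_sub_mul_nonneg {A H : ℝ → ℝ} (h : GrowthPair gl gu A H) {a b c : ℝ}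
    (hc : |c| ≤ |b - a|) (hcb : 0 ≤ c * (b - a)) :
    0 ≤ (A b - A a) * c ∧ ((A b - A a) * c = 0 → c = 0) := by
  rcases lt_trichotomy c 0 with hc0 | rfl | hc0
  · have h1 : b - a < 0 := by
      rcases lt_or_eq_of_le (nonpos_of_mul_nonneg_right hcb hc0) with h1 | h1
      · exact h1
      · rw [h1, abs_zero] at hc
        exact absurd (abs_nonpos_iff.1 hc) hc0.ne
    have h2 := h.strictMono (sub_neg.1 h1)
    have h3 : 0 < (A b - A a) * c := mul_pos_of_neg_of_neg (sub_neg.2 h2) hc0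
    exact ⟨h3.le, fun h4 => absurd h4 h3.ne'⟩
  · simp
  · have h1 : 0 < b - a := by
      rcases (nonneg_of_mul_nonneg_right hcb hc0).lt_or_eq with h1 | h1
      · exact h1
      · rw [← h1, abs_zero] at hc
        exact absurd (abs_nonpos_iff.1 hc) hc0.ne'
    have h2 := h.strictMono (sub_pos.1 h1)
    have h3 : 0 < (A b - A a) * c := mul_pos (sub_pos.2 h2) hc0
    exact ⟨h3.le, fun h4 => absurd h4 h3.ne'⟩

/-- Two solutions are compared by testing with `w = (u' - u - k)⁺`. -/
lemma IsSolution.le_add (hs : 0 < s) (hΩb : Bornology.IsBounded Ω) {F' : (Rd d → ℝ) → ℝ}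
    {K' : Set (Rd d → ℝ)} {u u' : Rd d → ℝ} {k : ℝ} (hk : 0 ≤ k)
    (hF' : IsDualElement g s Ω F') (hFF' : DualGE g s Ω F F') (hK : K ⊆ W0 g s Ω)
    (hK' : K' ⊆ W0 g s Ω) (hu : IsSolution g s K F u) (hu' : IsSolution g s K' F' u')
    (hw : u + (fun x => max ((u' - u) x - k) 0) ∈ K)
    (hw' : u' - (fun x => max ((u' - u) x - k) 0) ∈ K') : ∀ᵐ x, u' x ≤ u x + k := by
  have hfam := hg.growthFamily hd
  have huW := hK hu.1
  have huW' := hK' hu'.1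
  have hdW := W0.sub_mem hg hd huW' huW
  have hwW := W0.trunc_mem hg hd hs hΩb hdW hk
  set w : Rd d → ℝ := fun x => max ((u' - u) x - k) 0 with hwdef
  have h1 := hu.2 _ hw
  have h2 := hu'.2 _ hw'
  rw [add_sub_cancel_left] at h1
  rw [sub_sub_cancel_left, ← neg_one_smul ℝ w, hF'.map_smul _ _ hwW, opL_eq, quot_smul] at h2
  simp only [mul_left_comm _ (-1 : ℝ)] at h2
  rw [integral_const_mul, ← opL_eq] at h2
  have h3 := hFF' w hwW (Eventually.of_forall fun x => le_max_right _ _)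
  have i1 := hfam.integrable_deriv_mul (W0.finMod hg hd huW') (W0.finMod hg hd hwW)
  have i2 := hfam.integrable_deriv_mul (W0.finMod hg hd huW) (W0.finMod hg hd hwW)
  have hpt : ∀ᵐ p : Rd d × Rd d,
      0 ≤ (weightedDeriv g p (quot s u' p) - weightedDeriv g p (quot s u p)) * quot s w p ∧
      ((weightedDeriv g p (quot s u' p) - weightedDeriv g p (quot s u p)) * quot s w p = 0 →
        quot s w p = 0) := by
    filter_upwards [hfam.pair] with p hp
    have e1 := abs_quot_comp_le (s := s) (abs_max_sub_max_le k) (u' - u) p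
    have e2 := quot_max_mul_nonneg (s := s) (u' - u) k p
    have e3 : quot s (u' - u) p = quot s u' p - quot s u p := by rw [quot_sub]
    rw [e3] at e1 e2
    exact hp.deriv_sub_mul_nonneg e1 e2
  -- The two variational inequalities are added, and `F' w ≤ F w` because `w ≥ 0`.
  have hint : ∫ p, (weightedDeriv g p (quot s u' p) - weightedDeriv g p (quot s u p)) *
      quot s w p ≤ 0 := by
    simp only [sub_mul]
    rw [integral_sub i1 i2, ← opL_eq, ← opL_eq]
    linarith
  have hnn : 0 ≤ᵐ[volume] fun p => (weightedDeriv g p (quot s u' p) -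
      weightedDeriv g p (quot s u p)) * quot s w p := hpt.mono fun p hp => hp.1
  have hi : Integrable (fun p => (weightedDeriv g p (quot s u' p) -
      weightedDeriv g p (quot s u p)) * quot s w p) volume := by
    simp only [sub_mul]
    exact i1.sub i2
  -- A nonnegative integrand with nonpositive integral vanishes a.e., so the quotient of `w` is zero
  -- and `w`, vanishing outside `Ω`, is zero a.e.
  have hzero := (integral_eq_zero_iff_of_nonneg_ae hnn hi).1
    (le_antisymm hint (integral_nonneg_of_ae hnn))
  have hw0 := ae_eq_zero_of_quot hd hs hΩb hwW.2.1 (s := s) <| by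
    filter_upwards [hpt, hzero] with p hp hp' using hp.2 hp'
  filter_upwards [hw0] with x hx
  have : (u' - u) x - k ≤ 0 := by
    rw [← hx]
    exact le_max_left _ _
  simp only [Pi.sub_apply] at this
  linarith

/-! ### The obstacle constraints -/

lemma isConstraintSet_K1 (ψ : Rd d → ℝ) : IsConstraintSet g s Ω (K1 g s Ω ψ) where
  subset := fun _ hu => hu.1
  segment := fun u hu v hv t ht0 ht1 => by
    refine ⟨W0.add_mem hg hd hu.1 (W0.smul_mem hg hd t (W0.sub_mem hg hd hv.1 hu.1)), ?_⟩
    filter_upwards [hu.2, hv.2] with x hx hx'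
    simp only [Pi.add_apply, Pi.smul_apply, Pi.sub_apply, smul_eq_mul]
    nlinarith
  closed := fun v hv u hu hlim => by
    refine ⟨hu, ?_⟩
    filter_upwards [ae_restrict_of_ae hlim, ae_all_iff.2 fun n => (hv n).2] with x hx hx'
    exact ge_of_tendsto' hx hx'

lemma isConstraintSet_K2 (ψ φ : Rd d → ℝ) : IsConstraintSet g s Ω (K2 g s Ω ψ φ) where
  subset := fun _ hu => hu.1
  segment := fun u hu v hv t ht0 ht1 => by
    refine ⟨W0.add_mem hg hd hu.1 (W0.smul_mem hg hd t (W0.sub_mem hg hd hv.1 hu.1)), ?_⟩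
    filter_upwards [hu.2, hv.2] with x hx hx'
    simp only [Pi.add_apply, Pi.smul_apply, Pi.sub_apply, smul_eq_mul]
    constructor <;> nlinarith
  closed := fun v hv u hu hlim => by
    refine ⟨hu, ?_⟩
    filter_upwards [ae_restrict_of_ae hlim, ae_all_iff.2 fun n => (hv n).2] with x hx hx'
    exact ⟨ge_of_tendsto' hx fun n => (hx' n).1, le_of_tendsto' hx fun n => (hx' n).2⟩

/-- The competitors are `u + w = max u (u' - k)` and `u' - w = min u' (u + k)`; the second stays
above `ψ'` because `u + k ≥ ψ + k ≥ ψ'`. -/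
lemma IsSolution.le_add_K1 (hs : 0 < s) (hΩb : Bornology.IsBounded Ω) {F' : (Rd d → ℝ) → ℝ}
    {ψ ψ' u u' : Rd d → ℝ} {k : ℝ} (hk : 0 ≤ k)
    (hF' : IsDualElement g s Ω F') (hFF' : DualGE g s Ω F F')
    (hu : IsSolution g s (K1 g s Ω ψ) F u) (hu' : IsSolution g s (K1 g s Ω ψ') F' u')
    (hψ : ∀ᵐ x ∂volume.restrict Ω, ψ' x ≤ ψ x + k) : ∀ᵐ x, u' x ≤ u x + k := by
  have hwW := W0.trunc_mem hg hd hs hΩb (W0.sub_mem hg hd hu'.1.1 hu.1.1) hk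
  refine IsSolution.le_add hg hd hs hΩb hk hF' hFF' (fun _ h => h.1) (fun _ h => h.1) hu hu'
    ⟨W0.add_mem hg hd hu.1.1 hwW, ?_⟩ ⟨W0.sub_mem hg hd hu'.1.1 hwW, ?_⟩
  · filter_upwards [hu.1.2] with x hx
    simp only [Pi.add_apply]
    linarith [le_max_right ((u' - u) x - k) 0]
  · filter_upwards [hu.1.2, hu'.1.2, hψ] with x hx hx' hψx
    simp only [Pi.sub_apply]
    rcases max_choice (u' x - u x - k) 0 with h | h <;> rw [h] <;> linarith

lemma IsSolution.le_add_K2 (hs : 0 < s) (hΩb : Bornology.IsBounded Ω) {F' : (Rd d → ℝ) → ℝ}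
    {ψ ψ' φ φ' u u' : Rd d → ℝ} {k : ℝ} (hk : 0 ≤ k)
    (hF' : IsDualElement g s Ω F') (hFF' : DualGE g s Ω F F')
    (hu : IsSolution g s (K2 g s Ω ψ φ) F u) (hu' : IsSolution g s (K2 g s Ω ψ' φ') F' u')
    (hψ : ∀ᵐ x ∂volume.restrict Ω, ψ' x ≤ ψ x + k)
    (hφ : ∀ᵐ x ∂volume.restrict Ω, φ' x ≤ φ x + k) : ∀ᵐ x, u' x ≤ u x + k := by
  have hwW := W0.trunc_mem hg hd hs hΩb (W0.sub_mem hg hd hu'.1.1 hu.1.1) hk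
  refine IsSolution.le_add hg hd hs hΩb hk hF' hFF' (fun _ h => h.1) (fun _ h => h.1) hu hu'
    ⟨W0.add_mem hg hd hu.1.1 hwW, ?_⟩ ⟨W0.sub_mem hg hd hu'.1.1 hwW, ?_⟩
  -- The upper obstacle enters here: where the truncation is active, `u + w = u' - k ≤ φ' - k ≤ φ`.
  · filter_upwards [hu.1.2, hu'.1.2, hφ] with x hx hx' hφx
    simp only [Pi.add_apply, Pi.sub_apply]
    rcases max_choice (u' x - u x - k) 0 with h | h <;>
      have := le_max_right (u' x - u x - k) 0 <;> rw [h] at this ⊢ <;> constructor <;> linarith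
  · filter_upwards [hu.1.2, hu'.1.2, hψ] with x hx hx' hψx
    simp only [Pi.sub_apply]
    rcases max_choice (u' x - u x - k) 0 with h | h <;>
      have := le_max_right (u' x - u x - k) 0 <;> rw [h] at this ⊢ <;> constructor <;> linarith

/-- Uniqueness is the comparison estimate with shift `0`, applied to two solutions in both orders.
-/
lemma hasUniqueSolution (hs : 0 < s) (hΩ : IsOpen Ω) (hΩb : Bornology.IsBounded Ω)
    (hF : IsDualElement g s Ω F) (hK : IsConstraintSet g s Ω K) (hne : K.Nonempty)
    (hle : ∀ u u', IsSolution g s K F u → IsSolution g s K F u' → ∀ᵐ x, u' x ≤ u x + 0) :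
    HasUniqueSolution g s K F := by
  obtain ⟨u, hu⟩ := exists_isMinimiser hg hd hs hΩ hΩb hF hK hne
  have hsol := (isSolution_iff_isMinimiser hg hd hF hK u).2 hu
  refine ⟨u, hsol, fun w hw => ?_⟩
  filter_upwards [hle u w hsol hw, hle w u hw hsol] with x h1 h2
  linarith

omit hg hd in
lemma ae_abs_le_of_supNorm_le {f : Rd d → ℝ} {M : ℝ≥0∞} (hM : M ≠ ∞) (h : supNorm Ω f ≤ M) :
    ∀ᵐ x ∂volume.restrict Ω, |f x| ≤ M.toReal := by
  rw [supNorm, eLpNorm_exponent_top] at h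
  filter_upwards [ae_le_eLpNormEssSup (f := f) (μ := volume.restrict Ω)] with x hx
  have := ENNReal.toReal_mono hM (hx.trans h)
  rwa [toReal_enorm, Real.norm_eq_abs] at this

omit hg hd in
lemma supNorm_sub_le_of_ae {u u' : Rd d → ℝ} {M : ℝ≥0∞} (hM : M ≠ ∞)
    (h1 : ∀ᵐ x, u' x ≤ u x + M.toReal) (h2 : ∀ᵐ x, u x ≤ u' x + M.toReal) :
    supNorm Ω (u - u') ≤ M := by
  rw [supNorm, eLpNorm_exponent_top, ← ENNReal.ofReal_toReal hM]
  apply eLpNormEssSup_le_of_ae_bound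
  filter_upwards [ae_restrict_of_ae h1, ae_restrict_of_ae h2] with x hx1 hx2
  rw [Real.norm_eq_abs, Pi.sub_apply, abs_le]
  constructor <;> linarith

end Variational

end FracObstacle

open FracObstacle in
theorem mainTheorem5 (d : ℕ) (hd : 0 < d) (s : ℝ) (hs0 : 0 < s) (hs1 : s < 1)
    (g : Rd d → Rd d → ℝ → ℝ) (gl gu : ℝ) (hg : IsAdmissible g gl gu)
    (Ω : Set (Rd d)) (hΩ : IsOpen Ω) (hΩb : Bornology.IsBounded Ω) :
    -- the pairing `⟨ℒ_g^s u, v⟩` is given by a convergent integral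
    (∀ u ∈ W0 g s Ω, ∀ v ∈ W0 g s Ω, Integrable (opIntegrand g s u v) volume) ∧
    -- one obstacle: existence, uniqueness, and equivalence with the minimisation problem
    (∀ (F : (Rd d → ℝ) → ℝ) (ψ : Rd d → ℝ), IsDualElement g s Ω F →
      AEMeasurable ψ (volume.restrict Ω) → (K1 g s Ω ψ).Nonempty →
      HasUniqueSolution g s (K1 g s Ω ψ) F ∧
      ∀ u, IsSolution g s (K1 g s Ω ψ) F u ↔ IsMinimiser g s (K1 g s Ω ψ) F u) ∧
    -- two obstacles: existence, uniqueness, and equivalence with the minimisation problem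
    (∀ (F : (Rd d → ℝ) → ℝ) (ψ φ : Rd d → ℝ), IsDualElement g s Ω F →
      AEMeasurable ψ (volume.restrict Ω) → AEMeasurable φ (volume.restrict Ω) →
      (K2 g s Ω ψ φ).Nonempty →
      HasUniqueSolution g s (K2 g s Ω ψ φ) F ∧
      ∀ u, IsSolution g s (K2 g s Ω ψ φ) F u ↔ IsMinimiser g s (K2 g s Ω ψ φ) F u) ∧
    -- one obstacle: comparison
    (∀ (F F' : (Rd d → ℝ) → ℝ) (ψ ψ' u u' : Rd d → ℝ),
      IsDualElement g s Ω F → IsDualElement g s Ω F' →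
      AEMeasurable ψ (volume.restrict Ω) → AEMeasurable ψ' (volume.restrict Ω) →
      IsSolution g s (K1 g s Ω ψ) F u → IsSolution g s (K1 g s Ω ψ') F' u' →
      DualGE g s Ω F F' → (∀ᵐ x ∂volume.restrict Ω, ψ' x ≤ ψ x) →
      ∀ᵐ x ∂volume.restrict Ω, u' x ≤ u x) ∧
    -- two obstacles: comparison
    (∀ (F F' : (Rd d → ℝ) → ℝ) (ψ ψ' φ φ' u u' : Rd d → ℝ),
      IsDualElement g s Ω F → IsDualElement g s Ω F' →
      AEMeasurable ψ (volume.restrict Ω) → AEMeasurable ψ' (volume.restrict Ω) →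
      AEMeasurable φ (volume.restrict Ω) → AEMeasurable φ' (volume.restrict Ω) →
      IsSolution g s (K2 g s Ω ψ φ) F u → IsSolution g s (K2 g s Ω ψ' φ') F' u' →
      DualGE g s Ω F F' → (∀ᵐ x ∂volume.restrict Ω, φ' x ≤ φ x) →
      (∀ᵐ x ∂volume.restrict Ω, ψ' x ≤ ψ x) →
      ∀ᵐ x ∂volume.restrict Ω, u' x ≤ u x) ∧
    -- one obstacle: dependence on the obstacle in `L^∞(Ω)`
    (∀ (F : (Rd d → ℝ) → ℝ) (ψ ψ' u u' : Rd d → ℝ), IsDualElement g s Ω F →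
      AEMeasurable ψ (volume.restrict Ω) → AEMeasurable ψ' (volume.restrict Ω) →
      IsSolution g s (K1 g s Ω ψ) F u → IsSolution g s (K1 g s Ω ψ') F u' →
      supNorm Ω (u - u') ≤ supNorm Ω (ψ - ψ')) ∧
    -- two obstacles: dependence on the obstacles in `L^∞(Ω)`
    (∀ (F : (Rd d → ℝ) → ℝ) (ψ ψ' φ φ' u u' : Rd d → ℝ), IsDualElement g s Ω F →
      AEMeasurable ψ (volume.restrict Ω) → AEMeasurable ψ' (volume.restrict Ω) →
      AEMeasurable φ (volume.restrict Ω) → AEMeasurable φ' (volume.restrict Ω) →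
      IsSolution g s (K2 g s Ω ψ φ) F u → IsSolution g s (K2 g s Ω ψ' φ') F u' →
      supNorm Ω (u - u') ≤ max (supNorm Ω (ψ - ψ')) (supNorm Ω (φ - φ'))) := by
  have hrefl : ∀ F : (Rd d → ℝ) → ℝ, DualGE g s Ω F F := fun F v _ _ => le_rfl
  have hself : ∀ ψ : Rd d → ℝ, ∀ᵐ x ∂volume.restrict Ω, ψ x ≤ ψ x + 0 := fun ψ =>
    Eventually.of_forall fun x => (add_zero _).ge
  have hadd : ∀ ψ ψ' : Rd d → ℝ, (∀ᵐ x ∂volume.restrict Ω, ψ' x ≤ ψ x) →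
      ∀ᵐ x ∂volume.restrict Ω, ψ' x ≤ ψ x + 0 := fun ψ ψ' h => by simpa using h
  have habs : ∀ (ψ ψ' : Rd d → ℝ) (M : ℝ≥0∞), M ≠ ∞ → supNorm Ω (ψ - ψ') ≤ M →
      (∀ᵐ x ∂volume.restrict Ω, ψ' x ≤ ψ x + M.toReal) ∧
      ∀ᵐ x ∂volume.restrict Ω, ψ x ≤ ψ' x + M.toReal := fun ψ ψ' M hM h => by
    have h1 := ae_abs_le_of_supNorm_le hM h
    constructor <;> filter_upwards [h1] with x hx <;> rw [Pi.sub_apply, abs_le] at hx <;> linarith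
  refine ⟨fun u hu v hv => integrable_opIntegrand hg hd hu hv, fun F ψ hF _ hne => ⟨?_, ?_⟩,
    fun F ψ φ hF _ _ hne => ⟨?_, ?_⟩, ?_, ?_, ?_, ?_⟩
  · exact hasUniqueSolution hg hd hs0 hΩ hΩb hF (isConstraintSet_K1 hg hd ψ) hne
      fun u u' hu hu' => hu.le_add_K1 hg hd hs0 hΩb le_rfl hF (hrefl F) hu' (hself ψ)
  · exact isSolution_iff_isMinimiser hg hd hF (isConstraintSet_K1 hg hd ψ)
  · exact hasUniqueSolution hg hd hs0 hΩ hΩb hF (isConstraintSet_K2 hg hd ψ φ) hne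
      fun u u' hu hu' => hu.le_add_K2 hg hd hs0 hΩb le_rfl hF (hrefl F) hu' (hself ψ) (hself φ)
  · exact isSolution_iff_isMinimiser hg hd hF (isConstraintSet_K2 hg hd ψ φ)
  · intro F F' ψ ψ' u u' _ hF' _ _ hu hu' hFF' hψ
    have := hu.le_add_K1 hg hd hs0 hΩb le_rfl hF' hFF' hu' (hadd _ _ hψ)
    simpa using ae_restrict_of_ae this
  · intro F F' ψ ψ' φ φ' u u' _ hF' _ _ _ _ hu hu' hFF' hφ hψ
    have := hu.le_add_K2 hg hd hs0 hΩb le_rfl hF' hFF' hu' (hadd _ _ hψ) (hadd _ _ hφ)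
    simpa using ae_restrict_of_ae this
  · intro F ψ ψ' u u' hF _ _ hu hu'
    by_cases hM : supNorm Ω (ψ - ψ') = ∞
    · rw [hM]
      exact le_top
    obtain ⟨h1, h2⟩ := habs ψ ψ' _ hM le_rfl
    exact supNorm_sub_le_of_ae hM
      (hu.le_add_K1 hg hd hs0 hΩb ENNReal.toReal_nonneg hF (hrefl F) hu' h1)
      (hu'.le_add_K1 hg hd hs0 hΩb ENNReal.toReal_nonneg hF (hrefl F) hu h2)
  · intro F ψ ψ' φ φ' u u' hF _ _ _ _ hu hu'
    by_cases hM : max (supNorm Ω (ψ - ψ')) (supNorm Ω (φ - φ')) = ∞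
    · rw [hM]
      exact le_top
    obtain ⟨h1, h2⟩ := habs ψ ψ' _ hM (le_max_left _ _)
    obtain ⟨h3, h4⟩ := habs φ φ' _ hM (le_max_right _ _)
    exact supNorm_sub_le_of_ae hM
      (hu.le_add_K2 hg hd hs0 hΩb ENNReal.toReal_nonneg hF (hrefl F) hu' h1 h3)
      (hu'.le_add_K2 hg hd hs0 hΩb ENNReal.toReal_nonneg hF (hrefl F) hu h2 h4)
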